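/- For $\alpha\in\mathbb{R}$ and $z=x+iy\in\mathbb{C}$ put $\xi_\alpha(z)=x\cos\alpha+y\sin\alpha$, $\eta_\alpha(z)=-x\sin\alpha+y\cos\alpha$. For constants $k,k'\ge 0$ let $WP_\alpha(k,k')$ be the class of Borel measures $\mu$ on $\mathbb{C}$ such that $$\mu(A)\le k\,|\xi_\alpha(A)|+k'\,|\eta_\alpha(A)|$$ for every Borel set $A\subset\mathbb{C}$ for which the right-hand side is finite, where $|\cdot|$ is Lebesgue measure on $\mathbb{R}$. For $-\pi/2\le\alpha<\beta\le\pi/2$ and $k,k',l,l'\ge0$ let $WP_{\alpha,\beta}(k,k',l,l')$ be the class of Borel measures $\mu$ on $\mathbb{C}$ supported on the sector $\{z:\alpha\le\arg z\le\beta\}$ and such that $\mu\in WP_\alpha(k,k')$ and $\mu\in WP_\beta(l,l')$. **Theorem.** Let $k,k',l,l'\ge 0$, let $1\le p\le 2$ and $1/p+1/p'=1$ (with $p'=\infty$ if $p=1$). For all $-\pi/2\le\alpha<\beta\le\pi/2$ and all $\mu\in WP_{\alpha,\beta}(k,k',l,l')$, the Laplace transform $$\mathcal{L}f(z)=\int_0^\infty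 f(t)\,e^{-tz}\,dt$$ is a bounded operator from $L^p(\mathbb{R}_+)$ to $L^{p'}(d\mu)$: there is a unique bounded linear operator $\mathcal{L}:L^p(\mathbb{R}_+)\to L^{p'}(d\mu)$ that is given by this integral $\mu$-a.e. for every $f\in L^1(\mathbb{R}_+)\cap L^p(\mathbb{R}_+)$; for every $f\in L^p(\mathbb{R}_+)$ the integral converges absolutely and represents $\mathcal{L}f(z)$ for $\mu$-a.e. $z$ with $\operatorname{Re}z>0$. Moreover, its norm is bounded uniformly in $\alpha$, $\beta$ and $\mu$: $$\sup_{-\frac\pi2\le\alpha<\beta\le\frac\pi2}\ \sup_{\mu\in WP_{\alpha,\beta}(k,k',l,l')}\|\mathcal{L}\|_{L^p(\mathbb{R}_+)\to L^{p'}(d\mu)}\le(8\pi)^{1/p'}\left(\sqrt{6k+k'}+\sqrt{6l+l'}\right)^{2/p'}.$$ -/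

import Mathlib

open MeasureTheory Set
open scoped ENNReal NNReal

noncomputable section

/-- The rotated abscissa `ξ = x cos α + y sin α` of `z = x + i y`. -/
def rotXi (α : ℝ) (z : ℂ) : ℝ := z.re * Real.cos α + z.im * Real.sin α

/-- The rotated ordinate `η = -x sin α + y cos α` of `z = x + i y`. -/
def rotEta (α : ℝ) (z : ℂ) : ℝ := -z.re * Real.sin α + z.im * Real.cos α

/-- The class `WP_α(k, k')` of `α`-well-projected Borel measures on `ℂ` with projection constants
`k, k'`: `μ(A) ≤ k |A_ξ| + k' |A_η|` for all Borel sets `A`. The right-hand side is computed in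
`[0, ∞]` with `0 · ∞ = 0`; if it is infinite there is no condition on `A`. -/
def IsWellProjected (α : ℝ) (k k' : ℝ≥0) (μ : Measure ℂ) : Prop :=
  ∀ A : Set ℂ, MeasurableSet A →
    μ A ≤ (k : ℝ≥0∞) * volume (rotXi α '' A) + (k' : ℝ≥0∞) * volume (rotEta α '' A)

/-- The closed sector `α ≤ arg z ≤ β`, with its vertex `0`
(used for `-π/2 ≤ α < β ≤ π/2` only). -/
def closedSector (α β : ℝ) : Set ℂ := {z | z = 0 ∨ (α ≤ z.arg ∧ z.arg ≤ β)}

/-- The class `WP_{α,β}(k, k', l, l')` of Borel measures supported on the sector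
`α ≤ arg z ≤ β` and well-projected relative to both bounding rays. -/
structure IsSectorWellProjected (α β : ℝ) (k k' l l' : ℝ≥0) (μ : Measure ℂ) : Prop where
  supported : μ (closedSector α β)ᶜ = 0
  left : IsWellProjected α k k' μ
  right : IsWellProjected β l l' μ

/-- The integrand `t ↦ f(t) e^{-tz}` of the Laplace transform. -/
def laplaceKernel (f : ℝ → ℂ) (z : ℂ) (t : ℝ) : ℂ := f t * Complex.exp (-(t : ℂ) * z)

/-- The Laplace transform `∫_0^∞ f(t) e^{-tz} dt`. -/
def laplaceTransform (f : ℝ → ℂ) (z : ℂ) : ℂ := ∫ t in Ioi (0 : ℝ), laplaceKernel f z t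

/-- `L^p(ℝ_+)`, complex-valued. -/
abbrev LpHalfLine (p : ℝ≥0∞) := Lp ℂ p (volume.restrict (Ioi (0 : ℝ)))

/-- The bounded operator `T : L^p(ℝ_+) → L^q(dμ)` is given by the Laplace integral on the
dense subspace `L^1(ℝ_+) ∩ L^p(ℝ_+)`, where that integral converges absolutely on the whole
closed right half-plane. -/
def ExtendsLaplace {p q : ℝ≥0∞} [Fact (1 ≤ p)] [Fact (1 ≤ q)] {μ : Measure ℂ}
    (T : LpHalfLine p →L[ℂ] Lp ℂ q μ) : Prop :=
  ∀ f : LpHalfLine p, Integrable f (volume.restrict (Ioi (0 : ℝ))) →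
    T f =ᵐ[μ] laplaceTransform f

end

/-!
The statement follows from a Carleson embedding `L²(ℝ₊) → L²(μ)` by Riesz–Thorin interpolation
with the trivial bound `L¹(ℝ₊) → L^∞(μ)`.

*Geometry of `μ`.* The maps `rotXi` and `rotEta` are `1`-Lipschitz, so a well-projected measure
has linear growth: `μ A ≤ m * diam A` with `m = min (k + k') (l + l')`
(`IsWellProjected.hasLinearGrowth`). Apart from this, only the fact that `μ` lives on the closed
right half-plane is used.

*The embedding.* For `f ∈ L¹ ∩ L²` the function `F = laplaceTransform f` is the Poisson integral of
its values on the imaginary axis (`laplaceTransform_eq_poisson`), and these have squared `L²` norm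
`2π ‖f‖²` (`lintegral_sq_laplaceTransform_imaginaryAxis`). If `|F(x + iy)| > λ`, then the part
`h = (|F(i ·)| - λ/2)₊` of the boundary values has Poisson integral greater than `λ/2` at
`x + iy`, hence a large mean over an interval centred at `y` of radius greater than `x`
(`lintegral_poisson_mul_le`). The Vitali covering lemma applied to these intervals gives
`μ {|F| > λ} ≤ (8 / λ) m ∫ h` (`HasLinearGrowth.measure_laplaceTransform_gt_le`), and integration
over `λ` yields `∫ |F|² dμ ≤ 16 m ∫ |F(is)|² ds = 32 π m ‖f‖²`.
The constant fits, since `4 m ≤ (√(6k + k') + √(6l + l'))²`.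

*Interpolation.* For an integral operator whose kernel is bounded by `1`, the three lines theorem
is applied to the bilinear form obtained by raising the moduli of the two functions to complex
powers (`norm_bilinear_le_of_L2_bound`); the constant `A` of the squared `L²` bound becomes
`A^(1/p')` (`lintegral_rpow_le_of_L2_bound`).

*The operator.* It is the extension by density from `L¹ ∩ L^p`. Simple functions converging to `f`
in `L^p` and pointwise identify its values with the Laplace integral where `Re z > 0`.
-/

open scoped FourierTransform SchwartzMap ContDiff

/-! ### Fourier analysis on the line -/

theorem integral_fourier_mul_eq_flip {f g : ℝ → ℂ} (hf : Integrable f) (hg : Integrable g) :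
    ∫ u, 𝓕 f u * g u = ∫ t, f t * 𝓕 g t := by
  have h := VectorFourier.integral_fourierIntegral_smul_eq_flip (L := innerₗ ℝ)
    (μ := volume) (ν := volume) Real.continuous_fourierChar continuous_inner hf hg
  have hflip : (innerₗ ℝ).flip = innerₗ ℝ := by
    ext; simp
  rw [hflip] at h
  exact h

/-- On `L¹ ∩ L²` the Fourier integral represents the `L²` Fourier transform, hence is isometric
for the `L²` norm. -/
theorem eLpNorm_fourier_eq {f : ℝ → ℂ} (h1 : Integrable f) (h2 : MemLp f 2) :
    eLpNorm (𝓕 f) 2 volume = eLpNorm f 2 volume := by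
  set g : Lp ℂ 2 (volume : Measure ℝ) := 𝓕 (h2.toLp f) with hg
  have hcont : Continuous (𝓕 f) :=
    VectorFourier.fourierIntegral_continuous (L := innerₗ ℝ) Real.continuous_fourierChar
      continuous_inner h1
  have key : ∀ φ : 𝓢(ℝ, ℂ), ∫ x, φ x * g x = ∫ x, φ x * 𝓕 f x := by
    intro φ
    have e1 := congrArg (fun T => T φ) (Lp.fourier_toTemperedDistribution_eq (h2.toLp f))
    simp only [TemperedDistribution.fourier_apply, Lp.toTemperedDistribution_apply,
      smul_eq_mul] at e1
    rw [hg, ← e1, ← integral_fourier_mul_eq_flip φ.integrable h1]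
    refine integral_congr_ae ?_
    filter_upwards [h2.coeFn_toLp] with x hx
    rw [hx, SchwartzMap.fourier_coe]
  have hae : ∀ᵐ x, g x = 𝓕 f x := by
    refine ae_eq_of_integral_contDiff_smul_eq
      ((Lp.memLp g).locallyIntegrable (by norm_num)) hcont.locallyIntegrable ?_
    intro φ hφ hc
    have hc' : HasCompactSupport (fun x => (φ x : ℂ)) := hc.comp_left (g := Complex.ofReal) rfl
    have hφ' : ContDiff ℝ ∞ (fun x => (φ x : ℂ)) := Complex.ofRealCLM.contDiff.comp hφ
    have := key (hc'.toSchwartzMap hφ')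
    simpa [Complex.real_smul] using this
  rw [← eLpNorm_congr_ae hae, ← eLpNorm_congr_ae h2.coeFn_toLp, ← Lp.enorm_def, ← Lp.enorm_def]
  simp only [enorm_eq_nnnorm, ← norm_toNNReal]
  rw [hg, Lp.norm_fourier_eq]

/-- The inverse Fourier transform of `t ↦ exp (-x|t| - 2πiwt)` is a Poisson kernel centred
at `w`. -/
theorem fourierInv_exp_neg_abs {x : ℝ} (hx : 0 < x) (w u : ℝ) :
    𝓕⁻ (fun t : ℝ => Complex.exp (-(x * |t| : ℝ) - 2 * Real.pi * w * t * Complex.I)) u =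
      ((2 * x / (x ^ 2 + (2 * Real.pi * (u - w)) ^ 2) : ℝ) : ℂ) := by
  set a : ℂ := 2 * Real.pi * (u - w) * Complex.I with ha
  have hxa : (-(x : ℂ) + a).re < 0 := by simp [ha, hx]
  have hxa' : 0 < ((x : ℂ) + a).re := by simp [ha, hx]
  have hre : ((x : ℂ) ^ 2 - a ^ 2) = ((x ^ 2 + (2 * Real.pi * (u - w)) ^ 2 : ℝ) : ℂ) := by
    rw [ha, mul_pow, Complex.I_sq]; push_cast; ring
  have hne : ((x : ℂ) ^ 2 - a ^ 2) ≠ 0 := by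
    rw [hre]; exact_mod_cast (by positivity : x ^ 2 + (2 * Real.pi * (u - w)) ^ 2 ≠ 0)
  have e1 : ∀ t ∈ Ioi (0 : ℝ), Real.fourierChar (inner ℝ t u) •
      Complex.exp (-(x * |t| : ℝ) - 2 * Real.pi * w * t * Complex.I) =
        Complex.exp ((-(x : ℂ) + a) * t) := by
    intro t ht
    rw [abs_of_pos ht, Circle.smul_def, Real.fourierChar_apply, smul_eq_mul, ← Complex.exp_add]
    congr 1
    simp [ha]; ring
  have e2 : ∀ t ∈ Iic (0 : ℝ), Real.fourierChar (inner ℝ t u) •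
      Complex.exp (-(x * |t| : ℝ) - 2 * Real.pi * w * t * Complex.I) =
        Complex.exp (((x : ℂ) + a) * t) := by
    intro t ht
    rw [abs_of_nonpos ht, Circle.smul_def, Real.fourierChar_apply, smul_eq_mul, ← Complex.exp_add]
    congr 1
    simp [ha]; ring
  rw [Real.fourierInv_eq, ← intervalIntegral.integral_Iic_add_Ioi (b := 0),
    setIntegral_congr_fun measurableSet_Iic e2, setIntegral_congr_fun measurableSet_Ioi e1,
    integral_exp_mul_complex_Iic hxa', integral_exp_mul_complex_Ioi hxa]
  · have h1 : (x : ℂ) + a ≠ 0 := by intro h; rw [h] at hxa'; simp at hxa'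
    have h2 : -(x : ℂ) + a ≠ 0 := by intro h; rw [h] at hxa; simp at hxa
    have h3 : (((2 * x / (x ^ 2 + (2 * Real.pi * (u - w)) ^ 2) : ℝ)) : ℂ)
        = 2 * x / ((x : ℂ) ^ 2 - a ^ 2) := by
      rw [hre]; push_cast; ring
    rw [h3]
    simp only [Complex.ofReal_zero, mul_zero, Complex.exp_zero]
    field_simp
    ring
  · exact (integrableOn_exp_mul_complex_Iic hxa' 0).congr_fun (fun t ht => (e2 t ht).symm)
      measurableSet_Iic
  · exact (integrableOn_exp_mul_complex_Ioi hxa 0).congr_fun (fun t ht => (e1 t ht).symm)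
      measurableSet_Ioi

theorem integrable_poisson {x : ℝ} (hx : 0 < x) (y : ℝ) :
    Integrable (fun s : ℝ => x / (Real.pi * (x ^ 2 + (s - y) ^ 2))) := by
  have h := (((integrable_inv_one_add_sq).comp_div hx.ne').comp_sub_right y).const_mul
    (1 / (Real.pi * x))
  refine h.congr (Filter.Eventually.of_forall fun s => ?_)
  have : Real.pi ≠ 0 := Real.pi_ne_zero
  have h2 : x ^ 2 + (s - y) ^ 2 ≠ 0 := by positivity
  have h3 : 1 + ((s - y) / x) ^ 2 ≠ 0 := by positivity
  simp only
  field_simp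

theorem integral_poisson {x : ℝ} (hx : 0 < x) (y : ℝ) :
    ∫ s : ℝ, x / (Real.pi * (x ^ 2 + (s - y) ^ 2)) = 1 := by
  have h : ∀ s : ℝ, x / (Real.pi * (x ^ 2 + (s - y) ^ 2)) =
      (1 / (Real.pi * x)) * (1 + ((s - y) / x) ^ 2)⁻¹ := by
    intro s
    have h2 : x ^ 2 + (s - y) ^ 2 ≠ 0 := by positivity
    have h3 : 1 + ((s - y) / x) ^ 2 ≠ 0 := by positivity
    have := Real.pi_ne_zero
    field_simp
  simp_rw [h]
  rw [integral_const_mul, integral_sub_right_eq_self (fun s : ℝ => (1 + (s / x) ^ 2)⁻¹) y,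
    Measure.integral_comp_div (fun s : ℝ => (1 + s ^ 2)⁻¹) x, integral_univ_inv_one_add_sq,
    abs_of_pos hx, smul_eq_mul]
  have := Real.pi_ne_zero
  field_simp

/-! ### Boundary values of the Laplace transform -/

theorem fourier_indicator_eq_laplaceTransform (f : ℝ → ℂ) (u : ℝ) :
    𝓕 ((Ioi (0 : ℝ)).indicator f) u =
      laplaceTransform f ((2 * Real.pi * u : ℝ) * Complex.I) := by
  rw [Real.fourier_eq', laplaceTransform, ← integral_indicator measurableSet_Ioi]
  refine integral_congr_ae (Filter.Eventually.of_forall fun t => ?_)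
  by_cases ht : t ∈ Ioi (0 : ℝ)
  · simp only [indicator_of_mem ht, laplaceKernel, smul_eq_mul]
    rw [mul_comm]
    congr 2
    simp; ring
  · simp [indicator_of_notMem ht]

theorem integrable_exp_neg_abs {x : ℝ} (hx : 0 < x) (w : ℝ) :
    Integrable (fun t : ℝ =>
      Complex.exp (-(x * |t| : ℝ) - 2 * Real.pi * w * t * Complex.I)) := by
  have h : Integrable (fun t : ℝ => Real.exp (-(x * |t|))) := by
    rw [← integrableOn_univ, ← Iic_union_Ioi (a := (0 : ℝ))]
    refine IntegrableOn.union ?_ ?_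
    · refine (integrableOn_exp_mul_Iic hx 0).congr_fun (fun t ht => ?_) measurableSet_Iic
      rw [abs_of_nonpos ht]; simp
    · refine (integrableOn_exp_mul_Ioi (neg_lt_zero.2 hx) 0).congr_fun (fun t ht => ?_)
        measurableSet_Ioi
      rw [abs_of_pos ht]; simp
  refine Integrable.mono' h (by fun_prop) (Filter.Eventually.of_forall fun t => ?_)
  rw [Complex.norm_exp]
  simp

/-- On the open right half-plane the Laplace transform is the Poisson integral of its values on
the imaginary axis. -/
theorem laplaceTransform_eq_poisson {f : ℝ → ℂ} (hf : IntegrableOn f (Ioi 0)) {x : ℝ}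
    (hx : 0 < x) (y : ℝ) :
    laplaceTransform f (x + y * Complex.I) =
      ∫ s : ℝ, ((x / (Real.pi * (x ^ 2 + (s - y) ^ 2)) : ℝ) : ℂ) *
        laplaceTransform f (s * Complex.I) := by
  have hpi : Real.pi ≠ 0 := Real.pi_ne_zero
  set w : ℝ := y / (2 * Real.pi) with hw
  set E : ℝ → ℂ := fun t => Complex.exp (-(x * |t| : ℝ) - 2 * Real.pi * w * t * Complex.I) with hE
  set q : ℝ → ℂ := 𝓕⁻ E with hq
  have hqval : ∀ s : ℝ, q (s / (2 * Real.pi)) =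
      ((2 * Real.pi * (x / (Real.pi * (x ^ 2 + (s - y) ^ 2))) : ℝ) : ℂ) := by
    intro s
    rw [hq, hE, fourierInv_exp_neg_abs hx]
    congr 1
    have h1 : 2 * Real.pi * (s / (2 * Real.pi) - w) = s - y := by rw [hw]; field_simp
    have h2 : x ^ 2 + (s - y) ^ 2 ≠ 0 := by positivity
    rw [h1]; field_simp
  have hqint : Integrable q := by
    have h1 : Integrable (fun s => q (s / (2 * Real.pi))) := by
      simp_rw [hqval]
      exact (((integrable_poisson hx y).const_mul (2 * Real.pi))).ofReal
    have h2 := h1.comp_mul_right' (R := 2 * Real.pi) (by positivity)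
    refine h2.congr (Filter.Eventually.of_forall fun s => ?_)
    simp only
    congr 1; field_simp
  have hEint : Integrable E := integrable_exp_neg_abs hx w
  have hEcont : Continuous E := by rw [hE]; fun_prop
  have hFE : Integrable (𝓕 E) := by
    refine hqint.comp_neg.congr (Filter.Eventually.of_forall fun s => ?_)
    simp only [hq]
    rw [Real.fourierInv_eq_fourier_neg, neg_neg]
  have hinv : 𝓕 q = E := hEcont.fourier_fourierInv_eq hEint hFE
  have hf0 : Integrable ((Ioi (0 : ℝ)).indicator f) :=
    (integrable_indicator_iff measurableSet_Ioi).2 hf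
  have e1 : laplaceTransform f (x + y * Complex.I) =
      ∫ t, (Ioi (0 : ℝ)).indicator f t * 𝓕 q t := by
    rw [hinv, laplaceTransform, ← integral_indicator measurableSet_Ioi]
    refine integral_congr_ae (Filter.Eventually.of_forall fun t => ?_)
    by_cases ht : t ∈ Ioi (0 : ℝ)
    · simp only [indicator_of_mem ht, laplaceKernel, hE]
      congr 2
      have h2 : 2 * Real.pi * w = y := by rw [hw]; field_simp
      rw [abs_of_pos ht, ← h2]
      push_cast; ring
    · simp [indicator_of_notMem ht]
  rw [e1, ← integral_fourier_mul_eq_flip hf0 hqint]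
  have e2 := Measure.integral_comp_div
    (fun u => 𝓕 ((Ioi (0 : ℝ)).indicator f) u * q u) (2 * Real.pi)
  rw [abs_of_pos (by positivity : (0 : ℝ) < 2 * Real.pi)] at e2
  have e3 : ∫ u, 𝓕 ((Ioi (0 : ℝ)).indicator f) u * q u =
      (1 / (2 * Real.pi)) • ∫ s, 𝓕 ((Ioi (0 : ℝ)).indicator f) (s / (2 * Real.pi)) *
        q (s / (2 * Real.pi)) := by
    rw [e2, smul_smul]
    have : (1 / (2 * Real.pi)) * (2 * Real.pi) = 1 := by field_simp
    rw [this, one_smul]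
  rw [e3, ← integral_smul]
  refine integral_congr_ae (Filter.Eventually.of_forall fun s => ?_)
  simp only
  rw [fourier_indicator_eq_laplaceTransform, hqval]
  have h3 : 2 * Real.pi * (s / (2 * Real.pi)) = s := by field_simp
  rw [h3, Complex.real_smul]
  push_cast
  have : (Real.pi : ℂ) ≠ 0 := by exact_mod_cast hpi
  field_simp

theorem continuous_laplaceTransform_imaginaryAxis {f : ℝ → ℂ} (hf : IntegrableOn f (Ioi 0)) :
    Continuous (fun s : ℝ => laplaceTransform f (s * Complex.I)) := by
  have hcont : Continuous (𝓕 ((Ioi (0 : ℝ)).indicator f)) :=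
    VectorFourier.fourierIntegral_continuous (L := innerₗ ℝ) Real.continuous_fourierChar
      continuous_inner ((integrable_indicator_iff measurableSet_Ioi).2 hf)
  have := hcont.comp (continuous_id.div_const (2 * Real.pi))
  refine this.congr fun s => ?_
  simp only [Function.comp, id]
  rw [fourier_indicator_eq_laplaceTransform]
  congr 3
  field_simp

/-- Plancherel's theorem for the boundary values of the Laplace transform. -/
theorem lintegral_sq_laplaceTransform_imaginaryAxis {f : ℝ → ℂ} (h1 : IntegrableOn f (Ioi 0))
    (h2 : MemLp f 2 (volume.restrict (Ioi 0))) :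
    ∫⁻ s : ℝ, ‖laplaceTransform f (s * Complex.I)‖ₑ ^ 2 =
      ENNReal.ofReal (2 * Real.pi) * ∫⁻ t in Ioi 0, ‖f t‖ₑ ^ 2 := by
  have hP := eLpNorm_fourier_eq ((integrable_indicator_iff measurableSet_Ioi).2 h1)
    ((memLp_indicator_iff_restrict measurableSet_Ioi).2 h2)
  rw [eLpNorm_indicator_eq_eLpNorm_restrict measurableSet_Ioi] at hP
  have hsq : ∀ (g : ℝ → ℂ) (ν : Measure ℝ), ∫⁻ t, ‖g t‖ₑ ^ 2 ∂ν = eLpNorm g 2 ν ^ 2 := by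
    intro g ν
    have := eLpNorm_nnreal_pow_eq_lintegral (f := g) (μ := ν) (p := 2) two_ne_zero
    simpa using this.symm
  rw [hsq f, ← hP, ← hsq]
  have hpos : (0 : ℝ) < 2 * Real.pi := by positivity
  have hmap := Real.smul_map_volume_mul_left hpos.ne'
  rw [abs_of_pos hpos] at hmap
  conv_lhs => rw [← hmap]
  rw [lintegral_smul_measure, smul_eq_mul, lintegral_map]
  · congr 1
    refine lintegral_congr fun u => ?_
    rw [fourier_indicator_eq_laplaceTransform]
  · exact (continuous_laplaceTransform_imaginaryAxis h1).measurable.enorm.pow_const 2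
  · exact measurable_const_mul _

/-! ### Measures of linear growth -/

theorem lipschitzWith_rotXi (α : ℝ) : LipschitzWith 1 (rotXi α) := by
  refine LipschitzWith.of_dist_le_mul fun z w => ?_
  rw [NNReal.coe_one, one_mul, Real.dist_eq, Complex.dist_eq, Complex.norm_eq_sqrt_sq_add_sq]
  refine Real.le_sqrt_of_sq_le ?_
  rw [sq_abs, rotXi, rotXi, Complex.sub_re, Complex.sub_im]
  nlinarith [Real.sin_sq_add_cos_sq α, sq_nonneg ((z.re - w.re) * Real.sin α -
    (z.im - w.im) * Real.cos α)]

theorem lipschitzWith_rotEta (α : ℝ) : LipschitzWith 1 (rotEta α) := by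
  refine LipschitzWith.of_dist_le_mul fun z w => ?_
  rw [NNReal.coe_one, one_mul, Real.dist_eq, Complex.dist_eq, Complex.norm_eq_sqrt_sq_add_sq]
  refine Real.le_sqrt_of_sq_le ?_
  rw [sq_abs, rotEta, rotEta, Complex.sub_re, Complex.sub_im]
  nlinarith [Real.sin_sq_add_cos_sq α, sq_nonneg ((z.re - w.re) * Real.cos α +
    (z.im - w.im) * Real.sin α)]

/-- A measure of one-dimensional growth: the mass of a set is at most `m` times its diameter. -/
def HasLinearGrowth (m : ℝ≥0) (μ : Measure ℂ) : Prop :=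
  ∀ A : Set ℂ, MeasurableSet A → μ A ≤ m * Metric.ediam A

theorem IsWellProjected.hasLinearGrowth {α : ℝ} {k k' : ℝ≥0} {μ : Measure ℂ}
    (h : IsWellProjected α k k' μ) : HasLinearGrowth (k + k') μ := by
  intro A hA
  have h1 := (Real.volume_le_diam (rotXi α '' A)).trans ((lipschitzWith_rotXi α).ediam_image_le A)
  have h2 := (Real.volume_le_diam (rotEta α '' A)).trans
    ((lipschitzWith_rotEta α).ediam_image_le A)
  rw [ENNReal.coe_one, one_mul] at h1 h2
  calc μ A ≤ _ := h A hA
    _ ≤ k * Metric.ediam A + k' * Metric.ediam A := by gcongr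
    _ = _ := by rw [← add_mul]; norm_cast

/-- A weak type `(1, 1)` estimate for a measure of linear growth. If a function has large mean
over an interval centred at the height of `z` and no shorter than the distance of `z` to the
imaginary axis, for every point `z` of `E`, then `μ E` is controlled by the integral of the
function. This follows from the Vitali covering lemma for these intervals. -/
theorem HasLinearGrowth.measure_le_lintegral {m : ℝ≥0} {μ : Measure ℂ} (hμ : HasLinearGrowth m μ)
    {h : ℝ → ℝ≥0∞} {c : ℝ} (hc : 0 < c) {E : Set ℂ}
    (hE : ∀ z ∈ E, 0 ≤ z.re ∧ ∃ r > 0, z.re ≤ r ∧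
      ENNReal.ofReal (2 * r * c) ≤ ∫⁻ s in Metric.ball z.im r, h s) :
    μ E ≤ ENNReal.ofReal (3 / c) * m * ∫⁻ s, h s := by
  by_cases htop : ∫⁻ s, h s = ⊤
  · rcases eq_or_ne m 0 with rfl | hm
    · have h0 : μ univ = 0 := by simpa using hμ univ MeasurableSet.univ
      simp [measure_mono_null (subset_univ E) h0]
    · rw [htop, ENNReal.mul_top]
      · exact le_top
      · have : 0 < 3 / c := by positivity
        simp [hm, this]
  choose! hre r hr0 hzr hr using hE
  set H : ℝ := (∫⁻ s, h s).toReal with hH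
  have hrR : ∀ z ∈ E, r z ≤ H / (2 * c) := by
    intro z hz
    have h1 := (hr z hz).trans (setLIntegral_le_lintegral _ _)
    rw [ENNReal.ofReal_le_iff_le_toReal htop] at h1
    rw [le_div_iff₀ (by positivity)]
    linarith
  obtain ⟨u, huE, hdisj, hcov⟩ := Vitali.exists_disjoint_subfamily_covering_enlargement
    (fun z : ℂ => Metric.ball z.im (r z)) E r (4 / 3) (by norm_num) (fun z hz => (hr0 z hz).le)
    (H / (2 * c)) hrR (fun z hz => Metric.nonempty_ball.2 (hr0 z hz))
  have hcount : u.Countable := hdisj.countable_of_isOpen (fun z _ => Metric.isOpen_ball)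
    (fun z hz => Metric.nonempty_ball.2 (hr0 z (huE hz)))
  -- With enlargement factor `4 / 3` the points of `E` attached to `b` lie in a rectangle with
  -- sides `4 / 3 * r b` and `14 / 3 * r b`, of diameter at most `6 * r b`.
  set Q : ℂ → Set ℂ := fun b =>
    {z | 0 ≤ z.re ∧ z.re ≤ 4 / 3 * r b ∧ |z.im - b.im| ≤ 7 / 3 * r b} with hQ
  have hsub : E ⊆ ⋃ b ∈ u, Q b := by
    intro z hz
    obtain ⟨b, hb, ⟨s, hs1, hs2⟩, hle⟩ := hcov z hz
    refine mem_iUnion₂.2 ⟨b, hb, hre z hz, (hzr z hz).trans hle, ?_⟩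
    rw [Metric.mem_ball, Real.dist_eq] at hs1 hs2
    have : |z.im - b.im| ≤ |s - z.im| + |s - b.im| := by
      rw [abs_sub_comm s z.im]
      exact abs_sub_le _ _ _
    linarith
  have hQm : ∀ b, MeasurableSet (Q b) := by
    intro b
    refine (measurableSet_le measurable_const Complex.measurable_re).inter
      ((measurableSet_le Complex.measurable_re measurable_const).inter
        (measurableSet_le (f := fun z : ℂ => |z.im - b.im|) ?_ measurable_const))
    exact (continuous_abs.comp (Complex.continuous_im.sub continuous_const)).measurable
  have hQd : ∀ b ∈ u, μ (Q b) ≤ m * ENNReal.ofReal (6 * r b) := by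
    intro b hb
    refine (hμ _ (hQm b)).trans ?_
    gcongr
    refine Metric.ediam_le fun z hz w hw => ?_
    rw [edist_dist]
    apply ENNReal.ofReal_le_ofReal
    rw [Complex.dist_eq]
    refine (Complex.norm_le_abs_re_add_abs_im _).trans ?_
    rw [Complex.sub_re, Complex.sub_im]
    have h1 : |z.re - w.re| ≤ 4 / 3 * r b := by
      rw [abs_le]; constructor <;> linarith [hz.1, hz.2.1, hw.1, hw.2.1]
    have h2 : |z.im - w.im| ≤ |z.im - b.im| + |w.im - b.im| := by
      rw [abs_sub_comm w.im b.im]; exact abs_sub_le _ _ _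
    linarith [hz.2.2, hw.2.2]
  have hball : ∀ b ∈ u, ENNReal.ofReal (6 * r b) ≤
      ENNReal.ofReal (3 / c) * ∫⁻ s in Metric.ball b.im (r b), h s := by
    intro b hb
    calc ENNReal.ofReal (6 * r b) = ENNReal.ofReal (3 / c) * ENNReal.ofReal (2 * r b * c) := by
          rw [← ENNReal.ofReal_mul (by positivity)]
          congr 1; field_simp; ring
      _ ≤ _ := by gcongr; exact hr b (huE hb)
  have := hcount.to_subtype
  calc μ E ≤ μ (⋃ b ∈ u, Q b) := measure_mono hsub
    _ ≤ ∑' b : u, μ (Q b) := measure_biUnion_le μ hcount Q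
    _ ≤ ∑' b : u, (ENNReal.ofReal (3 / c) * m) *
          ∫⁻ s in Metric.ball (b : ℂ).im (r b), h s := by
        refine ENNReal.tsum_le_tsum fun b => (hQd b b.2).trans ?_
        rw [mul_comm (ENNReal.ofReal (3 / c)), mul_assoc]
        gcongr
        exact hball b b.2
    _ = (ENNReal.ofReal (3 / c) * m) * ∫⁻ s in ⋃ b ∈ u, Metric.ball b.im (r b), h s := by
        rw [ENNReal.tsum_mul_left, lintegral_biUnion hcount (fun b _ => measurableSet_ball) hdisj]
    _ ≤ _ := by gcongr; exact Measure.restrict_le_self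

/-- The Poisson kernel is dominated by a superposition of the means over the intervals longer
than `x`, of total mass `4 / π`. -/
theorem lintegral_poisson_mul_le {h : ℝ → ℝ≥0∞} (hh : Measurable h) {x y c : ℝ} (hx : 0 < x)
    (hc : 0 ≤ c)
    (hr : ∀ r, x < r → ∫⁻ s in Metric.ball y r, h s ≤ ENNReal.ofReal (2 * r * c)) :
    ∫⁻ s, ENNReal.ofReal (x / (Real.pi * (x ^ 2 + (s - y) ^ 2))) * h s ≤
      ENNReal.ofReal (4 / Real.pi * c) := by
  have hpi := Real.pi_pos
  have hint : ∀ a, 0 < a → ∀ p : ℝ, 1 < p → ∀ C : ℝ, 0 ≤ C →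
      ∫⁻ r in Ioi a, ENNReal.ofReal (C * r ^ (-p)) =
      ENNReal.ofReal (C * (a ^ (1 - p) / (p - 1))) := by
    intro a ha p hp C hC
    rw [← ofReal_integral_eq_lintegral_ofReal]
    · rw [integral_const_mul, integral_Ioi_rpow_of_lt (by linarith) ha]
      congr 2
      have h1 : -p + 1 = 1 - p := by ring
      rw [h1, ← neg_sub p 1, div_neg, neg_div, neg_neg]
    · exact (integrableOn_Ioi_rpow_of_lt (by linarith) ha).const_mul C
    · filter_upwards [ae_restrict_mem measurableSet_Ioi] with r hr
      have : 0 < r := ha.trans hr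
      positivity
  set W : ℝ → ℝ≥0∞ := fun r => ENNReal.ofReal (2 * x / Real.pi * r ^ (-(3 : ℝ))) with hW
  have hWm : Measurable W := by rw [hW]; fun_prop
  have hker : ∀ s, ENNReal.ofReal (x / (Real.pi * (x ^ 2 + (s - y) ^ 2))) ≤
      ∫⁻ r in Ioi x, W r * (Metric.ball y r).indicator (fun _ => 1) s := by
    intro s
    set a := max x |s - y| with ha
    have hapos : 0 < a := lt_max_of_lt_left hx
    calc _ ≤ ENNReal.ofReal (2 * x / Real.pi * (a ^ (1 - (3 : ℝ)) / (3 - 1))) := by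
          apply ENNReal.ofReal_le_ofReal
          have h1 : a ^ (1 - (3 : ℝ)) = (a ^ 2)⁻¹ := by
            rw [show (1 - (3 : ℝ)) = -(2 : ℕ) by norm_num, Real.rpow_neg hapos.le,
              Real.rpow_natCast]
          have h2 : a ^ 2 ≤ x ^ 2 + (s - y) ^ 2 := by
            rw [ha]
            rcases max_choice x |s - y| with h | h <;> rw [h]
            · nlinarith [sq_nonneg (s - y)]
            · rw [sq_abs]; nlinarith [sq_nonneg x]
          rw [h1]
          have h3 : 2 * x / Real.pi * ((a ^ 2)⁻¹ / (3 - 1)) = x / (Real.pi * a ^ 2) := by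
            field_simp; norm_num
          rw [h3]
          gcongr
      _ = ∫⁻ r in Ioi a, W r := (hint a hapos 3 (by norm_num) _ (by positivity)).symm
      _ = ∫⁻ r in Ioi a, W r * (Metric.ball y r).indicator (fun _ => 1) s := by
          refine setLIntegral_congr_fun measurableSet_Ioi fun r hr => ?_
          have : s ∈ Metric.ball y r := by
            rw [Metric.mem_ball, Real.dist_eq]; exact (le_max_right _ _).trans_lt hr
          simp [indicator_of_mem this]
      _ ≤ _ := lintegral_mono_set (Ioi_subset_Ioi (le_max_left _ _))
  calc _ ≤ ∫⁻ s, (∫⁻ r in Ioi x, W r * (Metric.ball y r).indicator (fun _ => 1) s) * h s := by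
        gcongr with s; exact hker s
    _ = ∫⁻ s, ∫⁻ r in Ioi x, W r * (Metric.ball y r).indicator h s := by
        refine lintegral_congr fun s => ?_
        rw [← lintegral_mul_const]
        · refine lintegral_congr fun r => ?_
          by_cases hs : s ∈ Metric.ball y r <;> simp [hs, mul_comm]
        · refine hWm.mul ?_
          have : (fun r => (Metric.ball y r).indicator (fun _ => (1 : ℝ≥0∞)) s) =
              (Ioi (dist s y)).indicator (fun _ => 1) := by
            ext r; simp [indicator, Metric.mem_ball]
          rw [this]
          exact measurable_const.indicator measurableSet_Ioi
    _ = ∫⁻ r in Ioi x, ∫⁻ s, W r * (Metric.ball y r).indicator h s := by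
        rw [lintegral_lintegral_swap]
        refine Measurable.aemeasurable ?_
        refine (hWm.comp measurable_snd).mul ?_
        have : (fun a : ℝ × ℝ => (Metric.ball y a.2).indicator h a.1) =
            {a : ℝ × ℝ | dist a.1 y < a.2}.indicator (fun a => h a.1) := by
          ext a; simp [indicator, Metric.mem_ball]
        rw [this]
        exact (hh.comp measurable_fst).indicator
          (measurableSet_lt (measurable_fst.dist measurable_const) measurable_snd)
    _ ≤ ∫⁻ r in Ioi x, ENNReal.ofReal (4 * x * c / Real.pi * r ^ (-(2 : ℝ))) := by
        refine setLIntegral_mono' measurableSet_Ioi fun r hr' => ?_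
        have hr0 : 0 < r := hx.trans hr'
        rw [lintegral_const_mul _ (hh.indicator measurableSet_ball),
          lintegral_indicator measurableSet_ball]
        calc _ ≤ W r * ENNReal.ofReal (2 * r * c) := by gcongr; exact hr r hr'
          _ = _ := by
            rw [hW, ← ENNReal.ofReal_mul (by positivity)]
            congr 1
            rw [show (-(2 : ℝ)) = -3 + 1 by norm_num, Real.rpow_add_one hr0.ne']
            ring
    _ = ENNReal.ofReal (4 * x * c / Real.pi * (x ^ (1 - (2 : ℝ)) / (2 - 1))) :=
        hint x hx 2 (by norm_num) _ (by positivity)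
    _ = _ := by
        congr 1
        rw [show (1 - (2 : ℝ)) = -1 by norm_num, Real.rpow_neg_one]
        field_simp; norm_num

/-! ### The Carleson embedding -/

theorem stronglyMeasurable_laplaceTransform {f : ℝ → ℂ} (hf : StronglyMeasurable f) :
    StronglyMeasurable (laplaceTransform f) := by
  have : StronglyMeasurable (fun q : ℂ × ℝ => laplaceKernel f q.1 q.2) := by
    refine (hf.comp_measurable measurable_snd).mul ?_
    exact (by fun_prop : Continuous fun q : ℂ × ℝ =>
      Complex.exp (-(q.2 : ℂ) * q.1)).stronglyMeasurable
  exact this.integral_prod_right'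

/-- The level sets of a Laplace transform, measured by a measure of linear growth, are controlled
by the part of the boundary values that lies above half the level. -/
theorem HasLinearGrowth.measure_laplaceTransform_gt_le {m : ℝ≥0} {μ : Measure ℂ}
    (hμ : HasLinearGrowth m μ) {f : ℝ → ℂ} (hf : IntegrableOn f (Ioi 0)) {l : ℝ} (hl : 0 < l) :
    μ {z | 0 ≤ z.re ∧ l < ‖laplaceTransform f z‖} ≤
      ENNReal.ofReal (8 / l) * m *
        ∫⁻ s : ℝ, ENNReal.ofReal (‖laplaceTransform f (s * Complex.I)‖ - l / 2) := by
  have hpi := Real.pi_pos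
  have hpi3 := Real.pi_gt_three
  have hpi4 := Real.pi_lt_four
  have hcont := (continuous_laplaceTransform_imaginaryAxis hf).norm
  set g : ℝ → ℝ := fun s => ‖laplaceTransform f (s * Complex.I)‖ with hg
  set h : ℝ → ℝ≥0∞ := fun s => ENNReal.ofReal (g s - l / 2) with hh
  have hhm : Measurable h := (hcont.measurable.sub_const _).ennreal_ofReal
  have hc : 0 < Real.pi * l / 8 := by positivity
  -- The threshold `π l / 8` makes the Poisson integral bound `4 / π * c` equal to `l / 2`, and it is
  -- below `l / 2`, as needed at the boundary points. The resulting constant is `24 / π ≤ 8`.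
  refine (hμ.measure_le_lintegral (h := h) hc ?_).trans ?_
  · rintro z ⟨hz0, hzl⟩
    refine ⟨hz0, ?_⟩
    rcases hz0.eq_or_lt with hz | hz
    · -- on the imaginary axis continuity of the boundary values replaces the Poisson formula
      have hzI : z = z.im * Complex.I := by
        apply Complex.ext <;> simp [← hz]
      have hgz : l < g z.im := by rw [hg]; simp only; rwa [← hzI]
      obtain ⟨r, hr, hball⟩ := Metric.eventually_nhds_iff_ball.1
        (hcont.continuousAt.eventually (lt_mem_nhds hgz))
      refine ⟨r, hr, hz ▸ hr.le, ?_⟩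
      calc ENNReal.ofReal (2 * r * (Real.pi * l / 8))
          ≤ ENNReal.ofReal (l / 2 * (2 * r)) := by
            apply ENNReal.ofReal_le_ofReal
            nlinarith [mul_pos hr hl]
        _ = ∫⁻ _ in Metric.ball z.im r, ENNReal.ofReal (l / 2) := by
            rw [setLIntegral_const, Real.volume_ball, ENNReal.ofReal_mul (by positivity)]
        _ ≤ _ := by
            refine setLIntegral_mono' measurableSet_ball fun s hs => ?_
            apply ENNReal.ofReal_le_ofReal
            have := hball s hs
            linarith
    · by_contra! hcon
      have hP := lintegral_poisson_mul_le hhm (y := z.im) hz hc.le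
        (fun r hr => (hcon r (hz.trans hr) hr.le).le)
      have h1 : (4 / Real.pi * (Real.pi * l / 8)) = l / 2 := by field_simp; norm_num
      rw [h1] at hP
      have hle : ENNReal.ofReal ‖laplaceTransform f z‖ ≤ ENNReal.ofReal l := by
        have hrep := laplaceTransform_eq_poisson hf hz z.im
        rw [Complex.re_add_im] at hrep
        rw [ofReal_norm, hrep]
        refine (enorm_integral_le_lintegral_enorm _).trans ?_
        calc _ ≤ ∫⁻ s, (ENNReal.ofReal (z.re / (Real.pi * (z.re ^ 2 + (s - z.im) ^ 2))) *
                ENNReal.ofReal (l / 2) +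
              ENNReal.ofReal (z.re / (Real.pi * (z.re ^ 2 + (s - z.im) ^ 2))) * h s) := by
              refine lintegral_mono fun s => ?_
              rw [← mul_add, enorm_mul, ← ofReal_norm, ← ofReal_norm,
                Complex.norm_real, Real.norm_of_nonneg (by positivity)]
              gcongr
              have : ‖laplaceTransform f (s * Complex.I)‖ = l / 2 + (g s - l / 2) := by
                rw [hg]; ring
              rw [this]
              exact ENNReal.ofReal_add_le
          _ = ENNReal.ofReal (l / 2) + ∫⁻ s,
              ENNReal.ofReal (z.re / (Real.pi * (z.re ^ 2 + (s - z.im) ^ 2))) * h s := by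
              rw [lintegral_add_right _ (by fun_prop), lintegral_mul_const _ (by fun_prop),
                ← ofReal_integral_eq_lintegral_ofReal (integrable_poisson hz z.im)
                  (Filter.Eventually.of_forall fun s => by positivity), integral_poisson hz]
              simp
          _ ≤ ENNReal.ofReal (l / 2) + ENNReal.ofReal (l / 2) := by gcongr
          _ = _ := by rw [← ENNReal.ofReal_add (by positivity) (by positivity)]; ring_nf
      exact absurd ((ENNReal.ofReal_le_ofReal_iff hl.le).1 hle) (not_le.2 hzl)
  · gcongr ENNReal.ofReal ?_ * _ * _
    rw [div_le_div_iff₀ hc hl]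
    nlinarith

theorem lintegral_Ioi_ofReal_sub_half {g : ℝ} (hg : 0 ≤ g) :
    ∫⁻ t in Ioi (0 : ℝ), ENNReal.ofReal (g - t / 2) = ENNReal.ofReal (g ^ 2) := by
  have h2 : (0 : ℝ) ≤ 2 * g := by positivity
  rw [← Ioc_union_Ioi_eq_Ioi h2, lintegral_union measurableSet_Ioi
    (Set.Ioc_disjoint_Ioi le_rfl)]
  have e1 : ∫⁻ t in Ioi (2 * g), ENNReal.ofReal (g - t / 2) = 0 := by
    rw [setLIntegral_congr_fun (g := fun _ => 0) measurableSet_Ioi]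
    · simp
    · intro t ht
      exact ENNReal.ofReal_of_nonpos (by have : 2 * g < t := ht; linarith)
  rw [e1, add_zero, ← ofReal_integral_eq_lintegral_ofReal,
    ← intervalIntegral.integral_of_le h2]
  · congr 1
    rw [intervalIntegral.integral_sub (by simp) (by simp), intervalIntegral.integral_div,
      integral_id, intervalIntegral.integral_const, smul_eq_mul]
    ring
  · exact (by fun_prop : Continuous fun t : ℝ => g - t / 2).integrableOn_Ioc
  · filter_upwards [ae_restrict_mem measurableSet_Ioc] with t ht
    have := ht.2
    simp only [Pi.zero_apply]
    linarith

/-- A Carleson embedding: the Laplace transform is bounded from `L²(ℝ₊)` to `L²(μ)` for every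
measure `μ` of linear growth on the closed right half-plane. -/
theorem HasLinearGrowth.lintegral_sq_laplaceTransform_le {m : ℝ≥0} {μ : Measure ℂ}
    (hμ : HasLinearGrowth m μ) (hre : ∀ᵐ z ∂μ, 0 ≤ z.re) {f : ℝ → ℂ} (hfm : StronglyMeasurable f)
    (h1 : IntegrableOn f (Ioi 0)) (h2 : MemLp f 2 (volume.restrict (Ioi 0))) :
    ∫⁻ z, ‖laplaceTransform f z‖ₑ ^ 2 ∂μ ≤
      ENNReal.ofReal (32 * Real.pi * m) * ∫⁻ t in Ioi 0, ‖f t‖ₑ ^ 2 := by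
  have hFm := (stronglyMeasurable_laplaceTransform hfm).norm.measurable
  have hcont := (continuous_laplaceTransform_imaginaryAxis h1).norm.measurable
  have hlc := lintegral_rpow_eq_lintegral_meas_lt_mul μ
    (Filter.Eventually.of_forall fun z => norm_nonneg (laplaceTransform f z))
    hFm.aemeasurable (p := 2) two_pos
  have hsq : ∀ z : ℂ, ‖z‖ₑ ^ 2 = ENNReal.ofReal (‖z‖ ^ 2) := by
    intro z
    rw [ENNReal.ofReal_pow (norm_nonneg _), ofReal_norm]
  have hGm : Measurable (fun q : ℝ × ℝ =>
      ENNReal.ofReal (‖laplaceTransform f (q.2 * Complex.I)‖ - q.1 / 2)) :=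
    ((hcont.comp measurable_snd).sub (measurable_fst.div_const 2)).ennreal_ofReal
  calc ∫⁻ z, ‖laplaceTransform f z‖ₑ ^ 2 ∂μ
      = ∫⁻ z, ENNReal.ofReal (‖laplaceTransform f z‖ ^ (2 : ℝ)) ∂μ := by
        refine lintegral_congr fun z => ?_
        rw [hsq, Real.rpow_two]
    _ = _ := hlc
    _ ≤ ENNReal.ofReal 2 * ∫⁻ t in Ioi (0 : ℝ), (8 * m) *
          ∫⁻ s : ℝ, ENNReal.ofReal (‖laplaceTransform f (s * Complex.I)‖ - t / 2) := by
        gcongr ENNReal.ofReal 2 * ?_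
        refine setLIntegral_mono' measurableSet_Ioi fun t (ht : 0 < t) => ?_
        have hset : μ {z | t < ‖laplaceTransform f z‖} ≤
            μ {z | 0 ≤ z.re ∧ t < ‖laplaceTransform f z‖} := by
          refine measure_mono_ae ?_
          filter_upwards [hre] with z hz h
          exact ⟨hz, h⟩
        have h8 : ENNReal.ofReal (8 / t) * ENNReal.ofReal t = 8 := by
          rw [← ENNReal.ofReal_mul (by positivity), div_mul_cancel₀ _ ht.ne']
          norm_num
        rw [show (2 : ℝ) - 1 = 1 by norm_num, Real.rpow_one]
        calc _ ≤ (ENNReal.ofReal (8 / t) * m * ∫⁻ s : ℝ,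
              ENNReal.ofReal (‖laplaceTransform f (s * Complex.I)‖ - t / 2)) *
                ENNReal.ofReal t := by
              gcongr
              exact hset.trans (hμ.measure_laplaceTransform_gt_le h1 ht)
          _ = (ENNReal.ofReal (8 / t) * ENNReal.ofReal t) * m * ∫⁻ s : ℝ,
              ENNReal.ofReal (‖laplaceTransform f (s * Complex.I)‖ - t / 2) := by ring
          _ = _ := by rw [h8]
    _ = ENNReal.ofReal 2 * (8 * m) * ∫⁻ s : ℝ, ∫⁻ t in Ioi (0 : ℝ),
          ENNReal.ofReal (‖laplaceTransform f (s * Complex.I)‖ - t / 2) := by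
        rw [lintegral_const_mul _ hGm.lintegral_prod_right', mul_assoc,
          lintegral_lintegral_swap hGm.aemeasurable]
        simp only [mul_assoc]
    _ = ENNReal.ofReal 2 * (8 * m) * ∫⁻ s : ℝ, ‖laplaceTransform f (s * Complex.I)‖ₑ ^ 2 := by
        congr 1
        refine lintegral_congr fun s => ?_
        rw [lintegral_Ioi_ofReal_sub_half (norm_nonneg _), hsq]
    _ = _ := by
        rw [lintegral_sq_laplaceTransform_imaginaryAxis h1 h2, ← mul_assoc]
        congr 1
        rw [← ENNReal.ofReal_coe_nnreal (p := m), show (8 : ℝ≥0∞) = ENNReal.ofReal 8 by norm_num,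
          ← ENNReal.ofReal_mul (by positivity), ← ENNReal.ofReal_mul (by positivity),
          ← ENNReal.ofReal_mul (by positivity)]
        congr 1; ring

/-! ### Complex powers of the modulus -/

/-- The number `w |w|^(s - 1)`, with value `0` at `w = 0`; an entire function of `s`. -/
noncomputable def phasePow (w s : ℂ) : ℂ := w / ‖w‖ * Complex.exp (s * Real.log ‖w‖)

theorem norm_phasePow_le (w s : ℂ) : ‖phasePow w s‖ ≤ Real.exp (|s.re| * |Real.log ‖w‖|) := by
  rw [phasePow, norm_mul, Complex.norm_exp, norm_div, Complex.norm_real, norm_norm]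
  have h1 : ‖w‖ / ‖w‖ ≤ 1 := div_self_le_one _
  have h2 : (s * (Real.log ‖w‖ : ℂ)).re ≤ |s.re| * |Real.log ‖w‖| := by
    rw [Complex.re_mul_ofReal, ← abs_mul]; exact le_abs_self _
  calc _ ≤ 1 * Real.exp (|s.re| * |Real.log ‖w‖|) := by gcongr
    _ = _ := one_mul _

theorem norm_phasePow {w s : ℂ} (hs : 0 < s.re) : ‖phasePow w s‖ = ‖w‖ ^ s.re := by
  rcases eq_or_ne w 0 with rfl | hw
  · simp [phasePow, Real.zero_rpow hs.ne']
  · have : 0 < ‖w‖ := norm_pos_iff.2 hw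
    rw [phasePow, norm_mul, Complex.norm_exp, norm_div, Complex.norm_real, norm_norm,
      div_self this.ne', one_mul, Complex.re_mul_ofReal, Real.rpow_def_of_pos this, mul_comm]

theorem phasePow_one (w : ℂ) : phasePow w 1 = w := by
  rcases eq_or_ne w 0 with rfl | hw
  · simp [phasePow]
  · have : 0 < ‖w‖ := norm_pos_iff.2 hw
    have h2 : (‖w‖ : ℂ) ≠ 0 := by exact_mod_cast this.ne'
    rw [phasePow, one_mul, ← Complex.ofReal_exp, Real.exp_log this, div_mul_cancel₀ _ h2]

theorem phasePow_zero_left (s : ℂ) : phasePow 0 s = 0 := by simp [phasePow]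

theorem mul_phasePow_conj (w : ℂ) {r : ℝ} (hr : 0 < r) :
    w * phasePow (starRingEnd ℂ w) r = ((‖w‖ ^ (r + 1) : ℝ) : ℂ) := by
  rcases eq_or_ne w 0 with rfl | hw
  · simp [Real.zero_rpow (by linarith : r + 1 ≠ 0)]
  · have h : 0 < ‖w‖ := norm_pos_iff.2 hw
    have h2 : (‖w‖ : ℂ) ≠ 0 := by exact_mod_cast h.ne'
    rw [phasePow, RCLike.norm_conj, Real.rpow_add_one h.ne', Real.rpow_def_of_pos h,
      mul_comm (Real.log ‖w‖) r, ← mul_assoc, ← mul_div_assoc, Complex.mul_conj,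
      Complex.normSq_eq_norm_sq]
    push_cast
    field_simp

theorem measurable_phasePow (s : ℂ) : Measurable (fun w => phasePow w s) := by
  unfold phasePow
  have h1 : Measurable (fun w : ℂ => ((‖w‖ : ℝ) : ℂ)) := by fun_prop
  have h2 : Measurable (fun w : ℂ => ((Real.log ‖w‖ : ℝ) : ℂ)) :=
    Complex.measurable_ofReal.comp (Real.measurable_log.comp measurable_norm)
  exact (measurable_id.div h1).mul (Complex.measurable_exp.comp (h2.const_mul s))

/-- The bound on `log |g|` confines `|g|` to a compact subset of `(0, ∞)` where `g ≠ 0`; it imposes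
nothing on the zeros of `g`, because `Real.log 0 = 0`. -/
theorem memLp_phasePow {X : Type*} [MeasurableSpace X] {ν : Measure X} {g : X → ℂ}
    (hg : Measurable g) (hfin : ν {x | g x ≠ 0} < ⊤) {L : ℝ} (hL : ∀ x, |Real.log ‖g x‖| ≤ L)
    (s : ℂ) (p : ℝ≥0∞) : MemLp (fun x => phasePow (g x) s) p ν := by
  have hS : MeasurableSet {x | g x ≠ 0} := hg (measurableSet_singleton 0).compl
  have : (fun x => phasePow (g x) s) = {x | g x ≠ 0}.indicator (fun x => phasePow (g x) s) := by
    ext x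
    by_cases hx : g x = 0
    · simp [hx, phasePow_zero_left]
    · simp [hx]
  rw [this, memLp_indicator_iff_restrict hS]
  have : IsFiniteMeasure (ν.restrict {x | g x ≠ 0}) := ⟨by simpa using hfin⟩
  refine MemLp.of_bound ((measurable_phasePow s).comp hg).aestronglyMeasurable
    (Real.exp (|s.re| * L)) (Filter.Eventually.of_forall fun x => ?_)
  refine (norm_phasePow_le _ _).trans ?_
  gcongr
  exact hL x

theorem norm_mul_exp_le {Z : Type*} {W : Z → ℂ} {ℓ : Z → ℝ} {L : ℝ} (hL : ∀ q, |ℓ q| ≤ L) (s : ℂ)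
    (q : Z) : ‖W q * Complex.exp (s * ℓ q)‖ ≤ Real.exp (|s.re| * L) * ‖W q‖ := by
  rw [norm_mul, Complex.norm_exp, mul_comm, Complex.re_mul_ofReal]
  refine mul_le_mul_of_nonneg_right (Real.exp_le_exp.2 ?_) (norm_nonneg _)
  calc s.re * ℓ q ≤ |s.re| * |ℓ q| := by rw [← abs_mul]; exact le_abs_self _
    _ ≤ _ := by gcongr; exact hL q

section Parameter

variable {Z : Type*} [MeasurableSpace Z] {ρ : Measure Z} {W : Z → ℂ} {ℓ : Z → ℝ} {L : ℝ}

theorem norm_integral_mul_exp_le (hW : Integrable W ρ) (hL : ∀ q, |ℓ q| ≤ L) (s : ℂ) :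
    ‖∫ q, W q * Complex.exp (s * ℓ q) ∂ρ‖ ≤ Real.exp (|s.re| * L) * ∫ q, ‖W q‖ ∂ρ := by
  rw [← integral_const_mul]
  exact norm_integral_le_of_norm_le (hW.norm.const_mul _)
    (Filter.Eventually.of_forall (norm_mul_exp_le hL s))

theorem differentiable_integral_mul_exp (hW : Integrable W ρ) (hℓ : Measurable ℓ)
    (hL : ∀ q, |ℓ q| ≤ L) :
    Differentiable ℂ (fun s : ℂ => ∫ q, W q * Complex.exp (s * ℓ q) ∂ρ) := by
  intro s
  have hm : ∀ s : ℂ, AEStronglyMeasurable (fun q => W q * Complex.exp (s * ℓ q)) ρ := fun s =>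
    hW.1.mul (by fun_prop : Measurable fun q => Complex.exp (s * ℓ q)).aestronglyMeasurable
  have hℓ' : AEStronglyMeasurable (fun q => (ℓ q : ℂ)) ρ :=
    (by fun_prop : Measurable fun q => (ℓ q : ℂ)).aestronglyMeasurable
  refine (hasDerivAt_integral_of_dominated_loc_of_deriv_le (μ := ρ)
    (F' := fun s q => W q * Complex.exp (s * ℓ q) * ℓ q)
    (bound := fun q => Real.exp ((‖s‖ + 1) * L) * ‖W q‖ * L)
    (Metric.ball_mem_nhds s one_pos) (Filter.Eventually.of_forall hm) ?_ ?_ ?_ ?_ ?_).2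
    |>.differentiableAt
  · exact (hW.norm.const_mul (Real.exp (|s.re| * L))).mono' (hm s)
      (Filter.Eventually.of_forall (norm_mul_exp_le hL s))
  · exact (hm s).mul hℓ'
  · refine Filter.Eventually.of_forall fun q t ht => ?_
    have hL0 : 0 ≤ L := (abs_nonneg _).trans (hL q)
    rw [norm_mul, Complex.norm_real, Real.norm_eq_abs]
    refine mul_le_mul ((norm_mul_exp_le hL t q).trans ?_) (hL q) (abs_nonneg _) (by positivity)
    gcongr
    refine (Complex.abs_re_le_norm t).trans ?_
    rw [Metric.mem_ball, dist_eq_norm] at ht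
    have := norm_le_norm_add_norm_sub' t s
    linarith
  · exact (hW.norm.const_mul _).mul_const _
  · refine Filter.Eventually.of_forall fun q t _ => ?_
    have h := ((hasDerivAt_id t).mul_const (ℓ q : ℂ)).cexp.const_mul (W q)
    simpa [mul_assoc] using h

end Parameter

/-! ### Three lines argument -/

section Interpolation

variable {X Y : Type*} [MeasurableSpace X] [MeasurableSpace Y] {ν : Measure X} {μ : Measure Y}
  [SFinite ν] [SFinite μ] {K : X → Y → ℂ}

/-- The three lines argument of the Riesz–Thorin theorem, in bilinear form, for the operator with
kernel `K`, `|K| ≤ 1`. The analytic family is obtained by raising the moduli of `f` and `G` to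
complex powers. -/
theorem norm_bilinear_le_of_L2_bound (hK : StronglyMeasurable (Function.uncurry K))
    (hK1 : ∀ x y, ‖K x y‖ ≤ 1) {A : ℝ≥0}
    (h2 : ∀ g : X → ℂ, StronglyMeasurable g → Integrable g ν → MemLp g 2 ν →
      ∫⁻ y, ‖∫ x, K x y * g x ∂ν‖ₑ ^ 2 ∂μ ≤ A * ∫⁻ x, ‖g x‖ₑ ^ 2 ∂ν)
    {p q : ℝ} (hpq : p.HolderConjugate q) (hp2 : p < 2)
    {f : X → ℂ} (hf : StronglyMeasurable f) (hf0 : ν {x | f x ≠ 0} < ⊤) {L : ℝ}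
    (hfL : ∀ x, |Real.log ‖f x‖| ≤ L)
    {G : Y → ℂ} (hG : Measurable G) (hG0 : μ {y | G y ≠ 0} < ⊤) {L' : ℝ}
    (hGL : ∀ y, |Real.log ‖G y‖| ≤ L') :
    ‖∫ y, phasePow (G y) (q / p : ℝ) * ∫ x, K x y * f x ∂ν ∂μ‖ ≤
      (A : ℝ) ^ (1 / q) * ((∫ x, ‖f x‖ ^ p ∂ν) * ∫ y, ‖G y‖ ^ q ∂μ) ^ (1 / p) := by
  have hp0 : 0 < p := hpq.pos
  have hq0 : 0 < q := hpq.symm.pos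
  have hpqi := hpq.inv_add_inv_eq_one
  set P : ℝ := ∫ x, ‖f x‖ ^ p ∂ν with hP
  set Q : ℝ := ∫ y, ‖G y‖ ^ q ∂μ with hQ
  have hP0 : 0 ≤ P := integral_nonneg fun x => by positivity
  have hQ0 : 0 ≤ Q := integral_nonneg fun x => by positivity
  have hfm := hf.measurable
  -- the family of bilinear forms
  set T : ℂ → X × Y → ℂ := fun s z =>
    K z.1 z.2 * phasePow (f z.1) (p * s) * phasePow (G z.2) (q * s) with hT
  have hint : ∀ s, Integrable (T s) (ν.prod μ) := by
    intro s
    have h1 := memLp_one_iff_integrable.1 (memLp_phasePow hfm hf0 hfL (p * s) 1)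
    have h2 := memLp_one_iff_integrable.1 (memLp_phasePow hG hG0 hGL (q * s) 1)
    have h3 := (h1.mul_prod h2).bdd_mul (c := 1) hK.aestronglyMeasurable
      (Filter.Eventually.of_forall fun z => hK1 z.1 z.2)
    refine h3.congr (Filter.Eventually.of_forall fun z => ?_)
    simp only [hT, Function.uncurry]
    ring
  set W : X × Y → ℂ := T 0 with hW
  set ℓ : X × Y → ℝ := fun z => p * Real.log ‖f z.1‖ + q * Real.log ‖G z.2‖ with hℓ
  have hTW : ∀ s z, T s z = W z * Complex.exp (s * ℓ z) := by
    intro s z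
    simp only [hW, hT, phasePow, hℓ, mul_zero, zero_mul, Complex.exp_zero, mul_one]
    have : (s * ((p * Real.log ‖f z.1‖ + q * Real.log ‖G z.2‖ : ℝ) : ℂ)) =
        p * s * Real.log ‖f z.1‖ + q * s * Real.log ‖G z.2‖ := by push_cast; ring
    rw [this, Complex.exp_add]
    ring
  have hℓm : Measurable ℓ := by
    refine ((Real.measurable_log.comp (hfm.comp measurable_fst).norm).const_mul p).add
      ((Real.measurable_log.comp (hG.comp measurable_snd).norm).const_mul q)
  have hℓL : ∀ z, |ℓ z| ≤ p * L + q * L' := by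
    intro z
    refine (abs_add_le _ _).trans ?_
    rw [abs_mul, abs_mul, abs_of_pos hp0, abs_of_pos hq0]
    gcongr
    exacts [hfL _, hGL _]
  set Φ : ℂ → ℂ := fun s => ∫ z, T s z ∂(ν.prod μ) with hΦ
  have hΦW : Φ = fun s => ∫ z, W z * Complex.exp (s * ℓ z) ∂(ν.prod μ) := by
    ext s; simp only [hΦ, hTW]
  have hdiff : Differentiable ℂ Φ := by
    rw [hΦW]; exact differentiable_integral_mul_exp (hint 0) hℓm hℓL
  have hFubini : ∀ s, Φ s =
      ∫ y, phasePow (G y) (q * s) * ∫ x, K x y * phasePow (f x) (p * s) ∂ν ∂μ := by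
    intro s
    simp only [hΦ]
    rw [integral_prod_symm _ (hint s)]
    refine integral_congr_ae (Filter.Eventually.of_forall fun y => ?_)
    simp only [hT]
    rw [integral_mul_const, mul_comm]
  -- the `L¹ → L^∞` side
  have hone : ∀ s : ℂ, s.re = 1 → ‖Φ s‖ ≤ P * Q := by
    intro s hs
    rw [hP, hQ, ← integral_prod_mul]
    refine norm_integral_le_of_norm_le ?_ (Filter.Eventually.of_forall fun z => ?_)
    · have e1 : Integrable (fun x => ‖f x‖ ^ p) ν := by
        refine (memLp_one_iff_integrable.1 (memLp_phasePow hfm hf0 hfL p 1)).norm.congr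
          (Filter.Eventually.of_forall fun x => ?_)
        simp only [norm_phasePow (s := p) (w := f x) (by simpa using hp0), Complex.ofReal_re]
      have e2 : Integrable (fun y => ‖G y‖ ^ q) μ := by
        refine (memLp_one_iff_integrable.1 (memLp_phasePow hG hG0 hGL q 1)).norm.congr
          (Filter.Eventually.of_forall fun x => ?_)
        simp only [norm_phasePow (s := q) (w := G x) (by simpa using hq0), Complex.ofReal_re]
      exact e1.mul_prod e2
    · simp only [hT]
      rw [norm_mul, norm_mul, norm_phasePow (by simp [hs, hp0]), norm_phasePow (by simp [hs, hq0])]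
      simp only [Complex.re_ofReal_mul, hs, mul_one]
      calc _ ≤ 1 * ‖f z.1‖ ^ p * ‖G z.2‖ ^ q := by gcongr; exact hK1 _ _
        _ = _ := by ring
  -- the `L² → L²` side
  have hhalf : ∀ s : ℂ, s.re = 1 / 2 → ‖Φ s‖ ≤ ((A : ℝ) * (P * Q)) ^ (1 / 2 : ℝ) := by
    intro s hs
    set fs : X → ℂ := fun x => phasePow (f x) (p * s) with hfs
    set gs : Y → ℂ := fun y => phasePow (G y) (q * s) with hgs
    have hfsm : Measurable fs := (measurable_phasePow _).comp hfm
    have hgsm : Measurable gs := (measurable_phasePow _).comp hG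
    have hsqr : ∀ (w : ℂ) (r : ℝ), 0 < r → ‖phasePow w (r * s)‖ₑ ^ 2 =
        ENNReal.ofReal (‖w‖ ^ r) := by
      intro w r hr
      rw [← ofReal_norm, norm_phasePow (by simp [hs, hr]), ← ENNReal.ofReal_pow (by positivity),
        ← Real.rpow_natCast, ← Real.rpow_mul (norm_nonneg _)]
      congr 2
      simp [hs]
    have hPe : ∫⁻ x, ‖fs x‖ₑ ^ 2 ∂ν = ENNReal.ofReal P := by
      rw [hP, ofReal_integral_eq_lintegral_ofReal]
      · exact lintegral_congr fun x => hsqr _ _ hp0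
      · refine (memLp_one_iff_integrable.1 (memLp_phasePow hfm hf0 hfL p 1)).norm.congr
          (Filter.Eventually.of_forall fun x => ?_)
        simp only [norm_phasePow (s := p) (w := f x) (by simpa using hp0), Complex.ofReal_re]
      · exact Filter.Eventually.of_forall fun x => by positivity
    have hQe : ∫⁻ y, ‖gs y‖ₑ ^ 2 ∂μ = ENNReal.ofReal Q := by
      rw [hQ, ofReal_integral_eq_lintegral_ofReal]
      · exact lintegral_congr fun x => hsqr _ _ hq0
      · refine (memLp_one_iff_integrable.1 (memLp_phasePow hG hG0 hGL q 1)).norm.congr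
          (Filter.Eventually.of_forall fun x => ?_)
        simp only [norm_phasePow (s := q) (w := G x) (by simpa using hq0), Complex.ofReal_re]
      · exact Filter.Eventually.of_forall fun x => by positivity
    have hT2 := h2 fs hfsm.stronglyMeasurable
      (memLp_one_iff_integrable.1 (memLp_phasePow hfm hf0 hfL _ 1))
      (memLp_phasePow hfm hf0 hfL _ 2)
    have hKm : StronglyMeasurable (fun y => ∫ x, K x y * fs x ∂ν) := by
      refine StronglyMeasurable.integral_prod_right'
        (f := fun z : Y × X => K z.2 z.1 * fs z.2) ?_
      exact (hK.comp_measurable measurable_swap).mul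
        (hfsm.stronglyMeasurable.comp_measurable measurable_snd)
    have hCS : ‖Φ s‖ₑ ≤ ENNReal.ofReal Q ^ (1 / 2 : ℝ) *
        (A * ENNReal.ofReal P) ^ (1 / 2 : ℝ) := by
      rw [hFubini]
      refine (enorm_integral_le_lintegral_enorm _).trans ?_
      simp_rw [enorm_mul]
      refine (ENNReal.lintegral_mul_le_Lp_mul_Lq μ Real.HolderConjugate.two_two
        hgsm.enorm.aemeasurable hKm.enorm.aemeasurable).trans ?_
      simp only [ENNReal.rpow_two]
      rw [hQe]
      gcongr
      rw [← hPe]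
      exact hT2
    have : ENNReal.ofReal Q ^ (1 / 2 : ℝ) * (A * ENNReal.ofReal P) ^ (1 / 2 : ℝ) =
        ENNReal.ofReal (((A : ℝ) * (P * Q)) ^ (1 / 2 : ℝ)) := by
      rw [← ENNReal.mul_rpow_of_nonneg _ _ (by norm_num), ← ENNReal.ofReal_coe_nnreal,
        ← ENNReal.ofReal_mul A.coe_nonneg, ← ENNReal.ofReal_mul hQ0,
        ENNReal.ofReal_rpow_of_nonneg (by positivity) (by norm_num)]
      ring_nf
    rw [this, ← ofReal_norm] at hCS
    exact (ENNReal.ofReal_le_ofReal_iff (by positivity)).1 hCS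
  -- The strip `0 ≤ re ζ ≤ 1` corresponds to `1 / 2 ≤ re s ≤ 1`, and `ζ = 2 / q` to `s = 1 / p`,
  -- where the exponents `p * s` and `q * s` are `1` and `q / p`.
  set ψ : ℂ → ℂ := fun ζ => Φ (1 - ζ / 2) with hψ
  have hq2 : 2 < q := by
    rw [hpq.conjugate_eq, lt_div_iff₀ (by linarith [hpq.lt])]; linarith
  have hθ : (2 / q : ℝ) ∈ Icc (0 : ℝ) 1 := ⟨by positivity, by rw [div_le_one hq0]; linarith⟩
  have hH := Complex.HadamardThreeLines.norm_le_interp_of_mem_verticalClosedStrip₀₁' ψ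
    (z := ((2 / q : ℝ) : ℂ)) (a := P * Q) (b := ((A : ℝ) * (P * Q)) ^ (1 / 2 : ℝ))
    (by simpa [Complex.HadamardThreeLines.verticalClosedStrip] using hθ)
    (hdiff.comp (by fun_prop : Differentiable ℂ fun ζ : ℂ => 1 - ζ / 2)).diffContOnCl
    ?_ ?_ ?_
  · have hval : ψ ((2 / q : ℝ) : ℂ) =
        ∫ y, phasePow (G y) (q / p : ℝ) * ∫ x, K x y * f x ∂ν ∂μ := by
      simp only [hψ]
      have hs : (1 - ((2 / q : ℝ) : ℂ) / 2) = ((1 / p : ℝ) : ℂ) := by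
        rw [one_div, ← sub_eq_of_eq_add hpqi.symm]
        push_cast
        ring
      rw [hs, hFubini]
      have e1 : (q : ℂ) * ((1 / p : ℝ) : ℂ) = ((q / p : ℝ) : ℂ) := by push_cast; ring
      have e2 : (p : ℂ) * ((1 / p : ℝ) : ℂ) = 1 := by
        rw [← Complex.ofReal_mul, mul_one_div_cancel hp0.ne', Complex.ofReal_one]
      rw [e1, e2]
      simp_rw [phasePow_one]
    rw [← hval]
    refine hH.trans (le_of_eq ?_)
    rw [Complex.ofReal_re, ← Real.rpow_mul (by positivity),
      Real.mul_rpow A.coe_nonneg (by positivity), mul_left_comm,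
      ← Real.rpow_add_of_nonneg (by positivity) (by linarith [hθ.2]) (by positivity)]
    congr 2
    · ring
    · have h1 : 1 / p = 1 - 1 / q := by rw [one_div, one_div]; linarith
      rw [h1]; ring
  · refine ⟨Real.exp (1 * (p * L + q * L')) * ∫ z, ‖W z‖ ∂(ν.prod μ), ?_⟩
    rintro _ ⟨ζ, hζ, rfl⟩
    simp only [Function.comp, hψ, hΦW]
    refine (norm_integral_mul_exp_le (hint 0) hℓL _).trans ?_
    by_cases hne : Nonempty (X × Y)
    · obtain ⟨z0⟩ := hne
      have hLL : 0 ≤ p * L + q * L' := (abs_nonneg _).trans (hℓL z0)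
      have : |(1 - ζ / 2).re| ≤ 1 := by
        have h1 : 0 ≤ ζ.re := hζ.1
        have h2 : ζ.re ≤ 1 := hζ.2
        have h3 : (1 - ζ / 2).re = 1 - ζ.re / 2 := by simp
        rw [h3, abs_le]; constructor <;> linarith
      gcongr
    · have : IsEmpty (X × Y) := not_nonempty_iff.1 hne
      simp [Measure.eq_zero_of_isEmpty]
  · intro ζ hζ
    have h1 : ζ.re = 0 := hζ
    exact hone _ (by simp [h1])
  · intro ζ hζ
    have h1 : ζ.re = 1 := hζ
    exact hhalf _ (by simp [h1]; norm_num)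

end Interpolation

/-! ### Riesz–Thorin interpolation -/

section RieszThorin

variable {X Y : Type*} [MeasurableSpace X] [MeasurableSpace Y] {ν : Measure X} {μ : Measure Y}
  [SFinite ν] [SFinite μ] {K : X → Y → ℂ}

/-- The interpolated estimate for functions supported on a set of finite measure with modulus
bounded above and below on the support. -/
theorem lintegral_rpow_le_of_L2_bound_of_log_bounded
    (hK : StronglyMeasurable (Function.uncurry K)) (hK1 : ∀ x y, ‖K x y‖ ≤ 1) {A : ℝ≥0}
    (h2 : ∀ g : X → ℂ, StronglyMeasurable g → Integrable g ν → MemLp g 2 ν →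
      ∫⁻ y, ‖∫ x, K x y * g x ∂ν‖ₑ ^ 2 ∂μ ≤ A * ∫⁻ x, ‖g x‖ₑ ^ 2 ∂ν)
    {p q : ℝ} (hpq : p.HolderConjugate q) (hp2 : p < 2)
    {f : X → ℂ} (hf : StronglyMeasurable f) (hf0 : ν {x | f x ≠ 0} < ⊤) {L : ℝ}
    (hfL : ∀ x, |Real.log ‖f x‖| ≤ L) :
    ∫⁻ y, ‖∫ x, K x y * f x ∂ν‖ₑ ^ q ∂μ ≤ A * (∫⁻ x, ‖f x‖ₑ ^ p ∂ν) ^ (q / p) := by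
  have hp0 : 0 < p := hpq.pos
  have hq0 : 0 < q := hpq.symm.pos
  have hpqi := hpq.inv_add_inv_eq_one
  have hfm := hf.measurable
  have hmem : ∀ r : ℝ≥0∞, MemLp f r ν := by
    intro r
    simpa only [phasePow_one] using memLp_phasePow hfm hf0 hfL 1 r
  have hfi : Integrable f ν := memLp_one_iff_integrable.1 (hmem 1)
  set F : Y → ℂ := fun y => ∫ x, K x y * f x ∂ν with hF
  have hFm : Measurable F := by
    refine (StronglyMeasurable.integral_prod_right'
      (f := fun z : Y × X => K z.2 z.1 * f z.2) ?_).measurable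
    exact (hK.comp_measurable measurable_swap).mul (hf.comp_measurable measurable_snd)
  set N : ℝ := ∫ x, ‖f x‖ ∂ν with hN
  have hFN : ∀ y, ‖F y‖ ≤ N := by
    intro y
    refine norm_integral_le_of_norm_le hfi.norm (Filter.Eventually.of_forall fun x => ?_)
    rw [norm_mul]
    exact mul_le_of_le_one_left (norm_nonneg _) (hK1 x y)
  have hF2 : ∫⁻ y, ‖F y‖ₑ ^ 2 ∂μ < ⊤ := by
    refine (h2 f hf hfi (hmem 2)).trans_lt (ENNReal.mul_lt_top ENNReal.coe_lt_top ?_)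
    have := (hmem 2).2
    rw [eLpNorm_lt_top_iff_lintegral_rpow_enorm_lt_top (by norm_num) (by norm_num)] at this
    simpa using this
  have hPi : Integrable (fun x => ‖f x‖ ^ p) ν := by
    refine (memLp_one_iff_integrable.1 (memLp_phasePow hfm hf0 hfL p 1)).norm.congr
      (Filter.Eventually.of_forall fun x => ?_)
    simp only [norm_phasePow (s := p) (w := f x) (by simpa using hp0), Complex.ofReal_re]
  have hrpow : ∀ (w : ℂ) {r : ℝ}, 0 < r → ‖w‖ₑ ^ r = ENNReal.ofReal (‖w‖ ^ r) := by
    intro w r hr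
    rw [← ofReal_norm, ENNReal.ofReal_rpow_of_nonneg (norm_nonneg _) hr.le]
  set P : ℝ := ∫ x, ‖f x‖ ^ p ∂ν with hP
  have hP0 : 0 ≤ P := integral_nonneg fun x => by positivity
  have hPe : ∫⁻ x, ‖f x‖ₑ ^ p ∂ν = ENNReal.ofReal P := by
    rw [hP, ofReal_integral_eq_lintegral_ofReal hPi
      (Filter.Eventually.of_forall fun x => by positivity)]
    exact lintegral_congr fun x => hrpow _ hp0
  -- Testing the bilinear estimate on `|F|^(q - 1)` times the conjugate phase of `F`, restricted
  -- to a level set so that all integrals are finite.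
  have hlevel : ∀ a : ℝ, 0 < a →
      ∫⁻ y in {y | a ≤ ‖F y‖}, ‖F y‖ₑ ^ q ∂μ ≤ A * (∫⁻ x, ‖f x‖ₑ ^ p ∂ν) ^ (q / p) := by
    intro a ha
    have hEm : MeasurableSet {y | a ≤ ‖F y‖} := measurableSet_le measurable_const hFm.norm
    set G : Y → ℂ := {y | a ≤ ‖F y‖}.indicator (fun y => starRingEnd ℂ (F y)) with hG
    have hGm : Measurable G := (Complex.continuous_conj.measurable.comp hFm).indicator hEm
    have hGsub : {y | G y ≠ 0} ⊆ {y | a ≤ ‖F y‖} := by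
      intro y hy
      by_contra hcon
      exact hy (indicator_of_notMem hcon _)
    have hGfin : μ {y | G y ≠ 0} < ⊤ := by
      refine (measure_mono hGsub).trans_lt ?_
      have hsub : {y | a ≤ ‖F y‖} ⊆ {y | ENNReal.ofReal a ^ 2 ≤ ‖F y‖ₑ ^ 2} := by
        intro y (hy : a ≤ ‖F y‖)
        simp only [mem_ofPred_eq, ← ofReal_norm]
        gcongr
      refine (measure_mono hsub).trans_lt ?_
      refine (meas_ge_le_lintegral_div (hFm.enorm.pow_const 2).aemeasurable ?_ ?_).trans_lt
        (ENNReal.div_lt_top hF2.ne ?_) <;> simp [ha]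
    have hGL : ∀ y, |Real.log ‖G y‖| ≤ max |Real.log a| |Real.log N| := by
      intro y
      by_cases hy : a ≤ ‖F y‖
      · have : ‖G y‖ = ‖F y‖ := by rw [hG, indicator_of_mem (show y ∈ {y | a ≤ ‖F y‖} from hy),
          RCLike.norm_conj]
        rw [this]
        exact abs_le_max_abs_abs (Real.log_le_log ha hy)
          (Real.log_le_log (ha.trans_le hy) (hFN y))
      · have : G y = 0 := indicator_of_notMem (show y ∉ {y | a ≤ ‖F y‖} from hy) _
        simp [this]
    have hmain := norm_bilinear_le_of_L2_bound hK hK1 h2 hpq hp2 hf hf0 hfL hGm hGfin hGL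
    have hqp : q / p + 1 = q := by
      rw [hpq.symm.conjugate_eq]
      have := hpq.symm.sub_one_ne_zero
      field_simp
      ring
    have hpt : ∀ y, phasePow (G y) (q / p : ℝ) * F y = ((‖G y‖ ^ q : ℝ) : ℂ) := by
      intro y
      by_cases hy : y ∈ {y | a ≤ ‖F y‖}
      · rw [hG, indicator_of_mem hy, RCLike.norm_conj, mul_comm,
          mul_phasePow_conj _ (by positivity), hqp]
      · rw [hG, indicator_of_notMem hy]
        simp [phasePow_zero_left, Real.zero_rpow hq0.ne']
    have hGi : Integrable (fun y => ‖G y‖ ^ q) μ := by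
      refine (memLp_one_iff_integrable.1 (memLp_phasePow hGm hGfin hGL q 1)).norm.congr
        (Filter.Eventually.of_forall fun x => ?_)
      simp only [norm_phasePow (s := q) (w := G x) (by simpa using hq0), Complex.ofReal_re]
    change ‖∫ y, phasePow (G y) (q / p : ℝ) * F y ∂μ‖ ≤ _ at hmain
    have hcongr : ∫ y, phasePow (G y) (q / p : ℝ) * F y ∂μ =
        ((∫ y, ‖G y‖ ^ q ∂μ : ℝ) : ℂ) := by
      simp_rw [hpt]
      exact integral_ofReal
    have hQe : ∫⁻ y in {y | a ≤ ‖F y‖}, ‖F y‖ₑ ^ q ∂μ =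
        ENNReal.ofReal (∫ y, ‖G y‖ ^ q ∂μ) := by
      rw [ofReal_integral_eq_lintegral_ofReal hGi
        (Filter.Eventually.of_forall fun x => by positivity), ← lintegral_indicator hEm]
      refine lintegral_congr fun y => ?_
      rw [← hrpow _ hq0]
      by_cases hy : y ∈ {y | a ≤ ‖F y‖}
      · rw [hG, indicator_of_mem hy, indicator_of_mem hy, 
          enorm_eq_iff_norm_eq.2 (RCLike.norm_conj (F y)).symm]
      · rw [hG, indicator_of_notMem hy, indicator_of_notMem hy, enorm_zero,
          ENNReal.zero_rpow_of_pos hq0]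
    rw [hcongr, Complex.norm_real, Real.norm_of_nonneg
      (integral_nonneg fun y => by positivity)] at hmain
    rw [hQe, hPe, ENNReal.ofReal_rpow_of_nonneg hP0 (by positivity), ← ENNReal.ofReal_coe_nnreal,
      ← ENNReal.ofReal_mul A.coe_nonneg]
    apply ENNReal.ofReal_le_ofReal
    set Q : ℝ := ∫ y, ‖G y‖ ^ q ∂μ with hQ
    have hQ0 : 0 ≤ Q := integral_nonneg fun y => by positivity
    -- `hmain` reads `Q ≤ A ^ (1 / q) * (P * Q) ^ (1 / p)`; divide by `Q ^ (1 / p)`.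
    rcases hQ0.eq_or_lt with h0 | hQpos
    · rw [← h0]; positivity
    have hsplit : Q = Q ^ (1 / q) * Q ^ (1 / p) := by
      rw [← Real.rpow_add hQpos, one_div, one_div, add_comm, hpqi, Real.rpow_one]
    have h3 : Q ^ (1 / q) ≤ (A : ℝ) ^ (1 / q) * P ^ (1 / p) := by
      rw [Real.mul_rpow hP0 hQ0, ← mul_assoc] at hmain
      nth_rewrite 1 [hsplit] at hmain
      exact le_of_mul_le_mul_right hmain (by positivity)
    calc Q = (Q ^ (1 / q)) ^ q := by
          rw [← Real.rpow_mul hQ0, one_div_mul_cancel hq0.ne', Real.rpow_one]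
      _ ≤ ((A : ℝ) ^ (1 / q) * P ^ (1 / p)) ^ q := by gcongr
      _ = _ := by
          rw [Real.mul_rpow (by positivity) (by positivity), ← Real.rpow_mul A.coe_nonneg,
            ← Real.rpow_mul hP0, one_div_mul_cancel hq0.ne', Real.rpow_one]
          congr 2; ring
  have hmono : Monotone (fun n : ℕ => {y | 1 / ((n : ℝ) + 1) ≤ ‖F y‖}) := by
    intro n k hnk y hy
    have hy' : 1 / ((n : ℝ) + 1) ≤ ‖F y‖ := hy
    exact (one_div_le_one_div_of_le (by positivity) (by gcongr)).trans hy'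
  have hunion : ∫⁻ y, ‖F y‖ₑ ^ q ∂μ =
      ∫⁻ y in ⋃ n : ℕ, {y | 1 / ((n : ℝ) + 1) ≤ ‖F y‖}, ‖F y‖ₑ ^ q ∂μ := by
    refine (setLIntegral_eq_of_support_subset ?_).symm
    intro y hy
    have hne : F y ≠ 0 := by
      rintro h
      simp [h, hq0] at hy
    obtain ⟨n, hn⟩ := exists_nat_one_div_lt (norm_pos_iff.2 hne)
    exact mem_iUnion.2 ⟨n, hn.le⟩
  rw [hunion, setLIntegral_iUnion_of_directed _ hmono.directed_le]
  exact iSup_le fun n => hlevel _ (by positivity)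

/-- The **Riesz–Thorin theorem** for an integral operator with a kernel bounded by `1`: an
`L² → L²` bound interpolates with the trivial `L¹ → L^∞` bound, without loss in the constant. -/
theorem lintegral_rpow_le_of_L2_bound
    (hK : StronglyMeasurable (Function.uncurry K)) (hK1 : ∀ x y, ‖K x y‖ ≤ 1) {A : ℝ≥0}
    (h2 : ∀ g : X → ℂ, StronglyMeasurable g → Integrable g ν → MemLp g 2 ν →
      ∫⁻ y, ‖∫ x, K x y * g x ∂ν‖ₑ ^ 2 ∂μ ≤ A * ∫⁻ x, ‖g x‖ₑ ^ 2 ∂ν)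
    {p q : ℝ} (hpq : p.HolderConjugate q) (hp2 : p < 2)
    {f : X → ℂ} (hf : StronglyMeasurable f) (hfi : Integrable f ν) :
    ∫⁻ y, ‖∫ x, K x y * f x ∂ν‖ₑ ^ q ∂μ ≤ A * (∫⁻ x, ‖f x‖ₑ ^ p ∂ν) ^ (q / p) := by
  have hp0 : 0 < p := hpq.pos
  have hq0 : 0 < q := hpq.symm.pos
  have hfm := hf.measurable
  set S : ℕ → Set X := fun n => {x | 1 / ((n : ℝ) + 1) ≤ ‖f x‖ ∧ ‖f x‖ ≤ (n : ℝ) + 1} with hS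
  have hSm : ∀ n, MeasurableSet (S n) := fun n =>
    (measurableSet_le measurable_const hfm.norm).inter (measurableSet_le hfm.norm measurable_const)
  set fn : ℕ → X → ℂ := fun n => (S n).indicator f with hfn
  have hfnm : ∀ n, StronglyMeasurable (fn n) := fun n => hf.indicator (hSm n)
  have hbound : ∀ n, ∫⁻ y, ‖∫ x, K x y * fn n x ∂ν‖ₑ ^ q ∂μ ≤
      A * (∫⁻ x, ‖f x‖ₑ ^ p ∂ν) ^ (q / p) := by
    intro n
    have hn : (0 : ℝ) < 1 / ((n : ℝ) + 1) := by positivity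
    have hfin : ν {x | fn n x ≠ 0} < ⊤ := by
      refine (measure_mono ?_).trans_lt (hfi.measure_norm_ge_lt_top hn)
      intro x hx
      by_contra hcon
      exact hx (indicator_of_notMem (fun h : x ∈ S n => hcon h.1) _)
    have hlog : ∀ x, |Real.log ‖fn n x‖| ≤
        max |Real.log (1 / ((n : ℝ) + 1))| |Real.log ((n : ℝ) + 1)| := by
      intro x
      by_cases hx : x ∈ S n
      · simp only [hfn, indicator_of_mem hx]
        exact abs_le_max_abs_abs (Real.log_le_log hn hx.1)
          (Real.log_le_log (hn.trans_le hx.1) hx.2)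
      · simp [hfn, indicator_of_notMem hx]
    refine (lintegral_rpow_le_of_L2_bound_of_log_bounded hK hK1 h2 hpq hp2 (hfnm n) hfin
      hlog).trans ?_
    gcongr with x
    exact enorm_indicator_le_enorm_self _ _
  have hlim : ∀ y, Filter.Tendsto (fun n => ∫ x, K x y * fn n x ∂ν) Filter.atTop
      (nhds (∫ x, K x y * f x ∂ν)) := by
    intro y
    have hKy : StronglyMeasurable (fun x => K x y) :=
      hK.comp_measurable (measurable_id.prodMk measurable_const)
    refine tendsto_integral_of_dominated_convergence (fun x => ‖f x‖)
      (fun n => (hKy.mul (hfnm n)).aestronglyMeasurable) hfi.norm (fun n => ?_) ?_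
    · refine Filter.Eventually.of_forall fun x => ?_
      rw [norm_mul]
      exact (mul_le_of_le_one_left (norm_nonneg _) (hK1 x y)).trans
        (norm_indicator_le_norm_self _ _)
    · refine Filter.Eventually.of_forall fun x => Filter.Tendsto.const_mul _ ?_
      rcases eq_or_ne (f x) 0 with h0 | h0
      · have : ∀ n, fn n x = f x := by
          intro n
          by_cases hx : x ∈ S n <;> simp [hfn, hx, h0]
        simp only [this]
        exact tendsto_const_nhds
      · obtain ⟨n1, hn1⟩ := exists_nat_one_div_lt (norm_pos_iff.2 h0)
        obtain ⟨n2, hn2⟩ := exists_nat_ge ‖f x‖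
        refine tendsto_const_nhds.congr' ?_
        filter_upwards [Filter.eventually_ge_atTop (max n1 n2)] with n hn
        have h1 : (n1 : ℝ) ≤ n := by exact_mod_cast (le_max_left _ _).trans hn
        have h2 : (n2 : ℝ) ≤ n := by exact_mod_cast (le_max_right _ _).trans hn
        have hx : x ∈ S n :=
          ⟨(one_div_le_one_div_of_le (by positivity) (by linarith)).trans hn1.le, by linarith⟩
        exact (indicator_of_mem hx f).symm
  have hmeas : ∀ n, Measurable (fun y => ‖∫ x, K x y * fn n x ∂ν‖ₑ ^ q) := by
    intro n
    refine Measurable.pow_const (Measurable.enorm ?_) q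
    refine (StronglyMeasurable.integral_prod_right'
      (f := fun z : Y × X => K z.2 z.1 * fn n z.2) ?_).measurable
    exact (hK.comp_measurable measurable_swap).mul ((hfnm n).comp_measurable measurable_snd)
  calc ∫⁻ y, ‖∫ x, K x y * f x ∂ν‖ₑ ^ q ∂μ
      = ∫⁻ y, Filter.liminf (fun n => ‖∫ x, K x y * fn n x ∂ν‖ₑ ^ q) Filter.atTop ∂μ := by
        refine lintegral_congr fun y => ?_
        exact (((ENNReal.continuous_rpow_const (y := q)).tendsto _).comp
          ((hlim y).enorm)).liminf_eq.symm
    _ ≤ Filter.liminf (fun n => ∫⁻ y, ‖∫ x, K x y * fn n x ∂ν‖ₑ ^ q ∂μ) Filter.atTop :=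
        lintegral_liminf_le hmeas
    _ ≤ _ := Filter.liminf_le_of_le (by isBoundedDefault) fun b hb => by
        obtain ⟨n, hn⟩ := hb.exists
        exact hn.trans (hbound n)

end RieszThorin

/-! ### Laplace transform estimates in `L^p` -/

theorem stronglyMeasurable_laplaceKernel {f : ℝ → ℂ} (hf : StronglyMeasurable f) (z : ℂ) :
    StronglyMeasurable (laplaceKernel f z) :=
  hf.mul (by fun_prop : Continuous fun t : ℝ => Complex.exp (-(t : ℂ) * z)).stronglyMeasurable

theorem norm_laplaceKernel (f : ℝ → ℂ) (z : ℂ) (t : ℝ) :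
    ‖laplaceKernel f z t‖ = ‖f t‖ * Real.exp (-(t * z.re)) := by
  rw [laplaceKernel, norm_mul, Complex.norm_exp]
  simp

theorem norm_laplaceKernel_le (f : ℝ → ℂ) {z : ℂ} (hz : 0 ≤ z.re) {t : ℝ} (ht : 0 < t) :
    ‖laplaceKernel f z t‖ ≤ ‖f t‖ := by
  rw [norm_laplaceKernel]
  refine mul_le_of_le_one_right (norm_nonneg _) (Real.exp_le_one_iff.2 ?_)
  have := mul_nonneg ht.le hz
  linarith

theorem integrableOn_laplaceKernel {f : ℝ → ℂ} (hf : StronglyMeasurable f)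
    (hfi : IntegrableOn f (Ioi 0)) {z : ℂ} (hz : 0 ≤ z.re) :
    IntegrableOn (laplaceKernel f z) (Ioi 0) := by
  refine Integrable.mono hfi (stronglyMeasurable_laplaceKernel hf z).aestronglyMeasurable ?_
  filter_upwards [ae_restrict_mem measurableSet_Ioi] with t ht
  exact norm_laplaceKernel_le f hz ht

/-- In the open half-plane the Laplace integral of an `L^p` function converges absolutely: where
`|f| ≥ 1` the integrand is dominated by `|f|^p`, elsewhere by the exponential. -/
theorem integrableOn_laplaceKernel_of_memLp {p : ℝ≥0∞} (hp1 : 1 ≤ p) (hp : p ≠ ⊤) {f : ℝ → ℂ}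
    (hf : StronglyMeasurable f) (hfp : MemLp f p (volume.restrict (Ioi 0))) {z : ℂ}
    (hz : 0 < z.re) : IntegrableOn (laplaceKernel f z) (Ioi 0) := by
  have h1 := hfp.integrable_norm_rpow (by positivity) hp
  have h2 : IntegrableOn (fun t : ℝ => Real.exp (-z.re * t)) (Ioi 0) :=
    integrableOn_exp_mul_Ioi (by linarith) 0
  refine (h1.add h2).mono' (stronglyMeasurable_laplaceKernel hf z).aestronglyMeasurable ?_
  filter_upwards [ae_restrict_mem measurableSet_Ioi] with t (ht : 0 < t)
  have hp1' : 1 ≤ p.toReal := by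
    rw [← ENNReal.toReal_one]; exact ENNReal.toReal_mono hp hp1
  simp only [Pi.add_apply]
  rcases le_total 1 ‖f t‖ with h | h
  · refine (norm_laplaceKernel_le f hz.le ht).trans ?_
    have : ‖f t‖ ≤ ‖f t‖ ^ p.toReal := by
      simpa using Real.rpow_le_rpow_of_exponent_le h hp1'
    have := Real.exp_pos (-z.re * t)
    linarith
  · rw [norm_laplaceKernel, show -(t * z.re) = -z.re * t by ring]
    have h3 : ‖f t‖ * Real.exp (-z.re * t) ≤ Real.exp (-z.re * t) :=
      mul_le_of_le_one_left (Real.exp_pos _).le h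
    have : 0 ≤ ‖f t‖ ^ p.toReal := by positivity
    linarith

theorem enorm_laplaceTransform_le (f : ℝ → ℂ) {z : ℂ} (hz : 0 ≤ z.re) :
    ‖laplaceTransform f z‖ₑ ≤ ∫⁻ t in Ioi 0, ‖f t‖ₑ := by
  refine (enorm_integral_le_lintegral_enorm _).trans ?_
  refine setLIntegral_mono' measurableSet_Ioi fun t ht => ?_
  exact enorm_le_iff_norm_le.2 (norm_laplaceKernel_le f hz ht)

theorem laplaceTransform_congr_ae {f g : ℝ → ℂ} (h : f =ᵐ[volume.restrict (Ioi 0)] g) :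
    laplaceTransform f = laplaceTransform g := by
  ext z
  refine integral_congr_ae ?_
  filter_upwards [h] with t ht
  simp only [laplaceKernel, ht]

theorem HasLinearGrowth.sigmaFinite {m : ℝ≥0} {μ : Measure ℂ} (hμ : HasLinearGrowth m μ) :
    SigmaFinite μ := by
  have : IsFiniteMeasureOnCompacts μ := ⟨fun C hC =>
    (hμ C hC.measurableSet).trans_lt
      (ENNReal.mul_lt_top ENNReal.coe_lt_top hC.isBounded.ediam_ne_top.lt_top)⟩
  infer_instance

/-- The interpolated estimate at a finite exponent `q = p' ≥ 2`. -/
theorem HasLinearGrowth.lintegral_rpow_laplaceTransform_le {m : ℝ≥0} {μ : Measure ℂ}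
    (hμ : HasLinearGrowth m μ) (hre : ∀ᵐ z ∂μ, 0 ≤ z.re) {p q : ℝ} (hpq : p.HolderConjugate q)
    (hp2 : p < 2) {f : ℝ → ℂ} (hf : StronglyMeasurable f) (hfi : IntegrableOn f (Ioi 0)) :
    ∫⁻ z, ‖laplaceTransform f z‖ₑ ^ q ∂μ ≤
      ENNReal.ofReal (32 * Real.pi * m) * (∫⁻ t in Ioi 0, ‖f t‖ₑ ^ p) ^ (q / p) := by
  have := hμ.sigmaFinite
  set S : Set (ℝ × ℂ) := {a | 0 < a.1 ∧ 0 ≤ a.2.re} with hS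
  have hSm : MeasurableSet S :=
    (measurableSet_lt measurable_const measurable_fst).inter
      (measurableSet_le measurable_const (Complex.measurable_re.comp measurable_snd))
  set K : ℝ → ℂ → ℂ := fun t z =>
    S.indicator (fun a : ℝ × ℂ => Complex.exp (-(a.1 : ℂ) * a.2)) (t, z) with hK
  have hKm : StronglyMeasurable (Function.uncurry K) :=
    (by fun_prop : Continuous fun a : ℝ × ℂ =>
      Complex.exp (-(a.1 : ℂ) * a.2)).stronglyMeasurable.indicator hSm
  have hK1 : ∀ t z, ‖K t z‖ ≤ 1 := by
    intro t z
    by_cases h : (t, z) ∈ S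
    · simp only [hK, indicator_of_mem h, Complex.norm_exp]
      refine Real.exp_le_one_iff.2 ?_
      have := mul_nonneg h.1.le h.2
      simp only [Complex.mul_re, Complex.neg_re, Complex.neg_im, Complex.ofReal_re,
        Complex.ofReal_im, neg_zero, zero_mul, sub_zero]
      linarith
    · simp [hK, indicator_of_notMem h]
  have hKF : ∀ (g : ℝ → ℂ) (z : ℂ), 0 ≤ z.re →
      ∫ t in Ioi 0, K t z * g t = laplaceTransform g z := by
    intro g z hz
    refine setIntegral_congr_fun measurableSet_Ioi fun t ht => ?_
    simp only [hK, indicator_of_mem (show (t, z) ∈ S from ⟨ht, hz⟩), laplaceKernel]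
    ring
  have hKae : ∀ (g : ℝ → ℂ) (r : ℝ), ∫⁻ z, ‖∫ t in Ioi 0, K t z * g t‖ₑ ^ r ∂μ =
      ∫⁻ z, ‖laplaceTransform g z‖ₑ ^ r ∂μ := by
    intro g r
    refine lintegral_congr_ae ?_
    filter_upwards [hre] with z hz
    rw [hKF g z hz]
  rw [← hKae, ENNReal.ofReal]
  refine lintegral_rpow_le_of_L2_bound hKm hK1 (fun g hg h1 h2 => ?_) hpq hp2 hf hfi
  have := hμ.lintegral_sq_laplaceTransform_le hre hg h1 h2
  simpa only [← hKae g 2, ENNReal.rpow_two, ENNReal.ofReal] using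
    (by simpa only [ENNReal.rpow_two] using (hKae g 2).le : _ ≤ _).trans this

theorem HasLinearGrowth.eLpNorm_laplaceTransform_le {m : ℝ≥0} {μ : Measure ℂ}
    (hμ : HasLinearGrowth m μ) (hre : ∀ᵐ z ∂μ, 0 ≤ z.re) {p p' : ℝ≥0∞} (hp1 : 1 ≤ p) (hp : p ≤ 2)
    (hpp' : ENNReal.HolderConjugate p p') {f : ℝ → ℂ} (hf : StronglyMeasurable f)
    (hfi : IntegrableOn f (Ioi 0)) (hfp : MemLp f p (volume.restrict (Ioi 0))) :
    eLpNorm (laplaceTransform f) p' μ ≤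
      ENNReal.ofReal ((32 * Real.pi * m) ^ (p'⁻¹).toReal) *
        eLpNorm f p (volume.restrict (Ioi 0)) := by
  rcases hp1.eq_or_lt with rfl | hp1
  · have : p' = ⊤ := (ENNReal.HolderConjugate.unique 1 ⊤ p').symm
    subst this
    simp only [ENNReal.inv_top, ENNReal.toReal_zero, Real.rpow_zero, ENNReal.ofReal_one, one_mul,
      eLpNorm_exponent_top, eLpNorm_one_eq_lintegral_enorm]
    refine essSup_le_of_ae_le _ ?_
    filter_upwards [hre] with z hz
    exact enorm_laplaceTransform_le f hz
  have hptop : p ≠ ⊤ := (hp.trans_lt (by norm_num)).ne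
  have hp'top : p' ≠ ⊤ := by
    have := (ENNReal.HolderConjugate.lt_top_iff_one_lt p' p).2 hp1
    exact this.ne
  have hpq : p.toReal.HolderConjugate p'.toReal :=
    ENNReal.HolderConjugate.toReal_of_ne_top hptop hp'top
  have hp0 : 0 < p.toReal := hpq.pos
  have hq0 : 0 < p'.toReal := hpq.symm.pos
  have hp'0 : p' ≠ 0 := by rintro rfl; simp at hq0
  have key : ∫⁻ z, ‖laplaceTransform f z‖ₑ ^ p'.toReal ∂μ ≤
      ENNReal.ofReal (32 * Real.pi * m) *
        (∫⁻ t in Ioi 0, ‖f t‖ₑ ^ p.toReal) ^ (p'.toReal / p.toReal) := by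
    rcases hp.eq_or_lt with rfl | hp2
    · have : p' = 2 := (ENNReal.HolderConjugate.unique 2 2 p').symm
      subst this
      simpa using hμ.lintegral_sq_laplaceTransform_le hre hf hfi hfp
    · refine hμ.lintegral_rpow_laplaceTransform_le hre hpq ?_ hf hfi
      simpa using (ENNReal.toReal_lt_toReal hptop (by norm_num)).2 hp2
  rw [eLpNorm_eq_lintegral_rpow_enorm_toReal hp'0 hp'top,
    eLpNorm_eq_lintegral_rpow_enorm_toReal (by positivity) hptop]
  have hA : (0 : ℝ) ≤ 32 * Real.pi * m := by positivity
  calc _ ≤ (ENNReal.ofReal (32 * Real.pi * m) *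
        (∫⁻ t in Ioi 0, ‖f t‖ₑ ^ p.toReal) ^ (p'.toReal / p.toReal)) ^ (1 / p'.toReal) := by
        gcongr
    _ = _ := by
        rw [ENNReal.mul_rpow_of_nonneg _ _ (by positivity), ← ENNReal.rpow_mul,
          ENNReal.ofReal_rpow_of_nonneg hA (by positivity), ENNReal.toReal_inv, one_div]
        congr 2
        field_simp

/-! ### The extended operator -/

open Filter Topology

/-- Every `f ∈ L^p(ℝ₊)`, `p < ∞`, is the limit in `L^p` and pointwise of functions in
`L¹ ∩ L^p`, dominated by `2 |f|`. -/
theorem exists_integrable_tendsto_Lp {p : ℝ≥0∞} [Fact (1 ≤ p)] (hp : p ≠ ⊤) (f : LpHalfLine p) :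
    ∃ u : ℕ → LpHalfLine p, ∃ v : ℕ → ℝ → ℂ, (∀ n, Integrable (u n) (volume.restrict (Ioi 0))) ∧
      Tendsto u atTop (𝓝 f) ∧ (∀ n, u n =ᵐ[volume.restrict (Ioi 0)] v n) ∧
      (∀ n, StronglyMeasurable (v n)) ∧ (∀ n t, ‖v n t‖ ≤ 2 * ‖f t‖) ∧
      ∀ t, Tendsto (fun n => v n t) atTop (𝓝 (f t)) := by
  have hfm : Measurable f := (Lp.stronglyMeasurable f).measurable
  have hp0 : p ≠ 0 := (zero_lt_one.trans_le (Fact.out : 1 ≤ p)).ne'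
  set v := fun n => SimpleFunc.approxOn f hfm (range f ∪ {0}) 0 (by simp) n with hv
  have hvp := SimpleFunc.memLp_approxOn_range hfm (Lp.memLp f)
  refine ⟨fun n => (hvp n).toLp (v n), fun n => v n, fun n => ?_, ?_, fun n => (hvp n).coeFn_toLp,
    fun n => (v n).stronglyMeasurable, fun n t => ?_, fun t => ?_⟩
  · exact ((SimpleFunc.memLp_iff_integrable hp0 hp).1 (hvp n)).congr (hvp n).coeFn_toLp.symm
  · have := SimpleFunc.tendsto_approxOn_range_Lp hp hfm (Lp.memLp f)
    rwa [Lp.toLp_coeFn] at this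
  · rw [two_mul]
    exact SimpleFunc.norm_approxOn_zero_le hfm (by simp) t n
  · exact SimpleFunc.tendsto_approxOn hfm _ (subset_closure (by simp))

/-- The subspace `L¹ ∩ L^p` of `L^p(ℝ₊)`. -/
def integrableSubmodule (p : ℝ≥0∞) : Submodule ℂ (LpHalfLine p) where
  carrier := {f | Integrable f (volume.restrict (Ioi (0 : ℝ)))}
  add_mem' {f g} hf hg := (Integrable.add hf hg).congr (Lp.coeFn_add f g).symm
  zero_mem' := (integrable_zero _ _ _).congr (Lp.coeFn_zero ℂ p _).symm
  smul_mem' c f hf := (Integrable.smul c hf).congr (Lp.coeFn_smul c f).symm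

theorem denseRange_subtype_integrableSubmodule {p : ℝ≥0∞} [Fact (1 ≤ p)] (hp : p ≠ ⊤) :
    DenseRange (integrableSubmodule p).subtype := by
  intro f
  obtain ⟨u, -, hu, hlim, -⟩ := exists_integrable_tendsto_Lp hp f
  exact mem_closure_of_tendsto hlim (Eventually.of_forall fun n => ⟨⟨u n, hu n⟩, rfl⟩)

theorem laplaceTransform_add {f g : ℝ → ℂ} (hf : StronglyMeasurable f) (hg : StronglyMeasurable g)
    (hfi : IntegrableOn f (Ioi 0)) (hgi : IntegrableOn g (Ioi 0)) {z : ℂ} (hz : 0 ≤ z.re) :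
    laplaceTransform (f + g) z = laplaceTransform f z + laplaceTransform g z := by
  rw [laplaceTransform, laplaceTransform, laplaceTransform,
    ← integral_add (integrableOn_laplaceKernel hf hfi hz) (integrableOn_laplaceKernel hg hgi hz)]
  simp only [laplaceKernel, Pi.add_apply, add_mul]

theorem laplaceTransform_smul (c : ℂ) (f : ℝ → ℂ) (z : ℂ) :
    laplaceTransform (c • f) z = c * laplaceTransform f z := by
  rw [laplaceTransform, laplaceTransform, ← integral_const_mul]
  simp only [laplaceKernel, Pi.smul_apply, smul_eq_mul, mul_assoc]

/-- For a measure of linear growth on the closed right half-plane, the Laplace transform on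
`L¹ ∩ L^p` extends to a bounded operator `L^p(ℝ₊) → L^{p'}(μ)`. -/
theorem HasLinearGrowth.exists_extendsLaplace {m : ℝ≥0} {μ : Measure ℂ}
    (hμ : HasLinearGrowth m μ) (hre : ∀ᵐ z ∂μ, 0 ≤ z.re) {p p' : ℝ≥0∞} [Fact (1 ≤ p)]
    [Fact (1 ≤ p')] (hp : p ≤ 2) (hpp' : ENNReal.HolderConjugate p p') :
    ∃ T : LpHalfLine p →L[ℂ] Lp ℂ p' μ, ExtendsLaplace T ∧
      (∀ S : LpHalfLine p →L[ℂ] Lp ℂ p' μ, ExtendsLaplace S → S = T) ∧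
      ‖T‖ ≤ (32 * Real.pi * m) ^ (p'⁻¹).toReal := by
  have hptop : p ≠ ⊤ := (hp.trans_lt (by norm_num)).ne
  have hp1 : 1 ≤ p := Fact.out
  set C : ℝ := (32 * Real.pi * m) ^ (p'⁻¹).toReal with hC
  have hC0 : 0 ≤ C := by positivity
  have hbound : ∀ f : integrableSubmodule p,
      eLpNorm (laplaceTransform (f : LpHalfLine p)) p' μ ≤
        ENNReal.ofReal C * eLpNorm (f : LpHalfLine p) p (volume.restrict (Ioi 0)) := fun f =>
    hμ.eLpNorm_laplaceTransform_le hre hp1 hp hpp' (Lp.stronglyMeasurable _) f.2 (Lp.memLp _)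
  have hmem : ∀ f : integrableSubmodule p,
      MemLp (laplaceTransform (f : LpHalfLine p)) p' μ := fun f =>
    ⟨(stronglyMeasurable_laplaceTransform (Lp.stronglyMeasurable _)).aestronglyMeasurable,
      (hbound f).trans_lt (ENNReal.mul_lt_top ENNReal.ofReal_lt_top (Lp.memLp _).2)⟩
  set T₀ : integrableSubmodule p →ₗ[ℂ] Lp ℂ p' μ :=
    { toFun := fun f => (hmem f).toLp _
      map_add' := by
        intro f g
        rw [← MemLp.toLp_add]
        refine MemLp.toLp_congr _ _ ?_
        filter_upwards [hre] with z hz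
        rw [Submodule.coe_add, laplaceTransform_congr_ae (Lp.coeFn_add (f : LpHalfLine p) g),
          laplaceTransform_add (Lp.stronglyMeasurable _) (Lp.stronglyMeasurable _) f.2 g.2 hz]
        rfl
      map_smul' := by
        intro c f
        rw [RingHom.id_apply, ← MemLp.toLp_const_smul]
        refine MemLp.toLp_congr _ _ (Eventually.of_forall fun z => ?_)
        rw [Submodule.coe_smul, laplaceTransform_congr_ae (Lp.coeFn_smul c (f : LpHalfLine p)),
          laplaceTransform_smul]
        rfl } with hT₀
  have hT₀norm : ∀ f : integrableSubmodule p, ‖T₀ f‖ ≤ C * ‖(integrableSubmodule p).subtype f‖ := by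
    intro f
    change ‖(hmem f).toLp _‖ ≤ C * ‖(f : LpHalfLine p)‖
    rw [Lp.norm_toLp, Lp.norm_def, ← ENNReal.toReal_ofReal hC0, ← ENNReal.toReal_mul]
    exact ENNReal.toReal_mono (ENNReal.mul_ne_top ENNReal.ofReal_ne_top (Lp.memLp _).2.ne)
      (hbound f)
  have hdense := denseRange_subtype_integrableSubmodule (p := p) hptop
  refine ⟨T₀.extendOfNorm (integrableSubmodule p).subtype, fun f hf => ?_, fun S hS => ?_,
    LinearMap.opNorm_extendOfNorm_le hdense hC0 hT₀norm⟩
  · have := LinearMap.extendOfNorm_eq hdense ⟨C, hT₀norm⟩ ⟨f, hf⟩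
    rw [Submodule.subtype_apply] at this
    rw [this]
    exact (hmem ⟨f, hf⟩).coeFn_toLp
  · refine (LinearMap.extendOfNorm_unique hdense C hT₀norm S ?_).symm
    ext1 f
    refine Lp.ext ((hS f f.2).trans ?_)
    exact (hmem f).coeFn_toLp.symm

/-- A bounded extension of the Laplace transform is given by the Laplace integral at almost all
points of the open half-plane, since convergence in `L^q(μ)` implies convergence almost everywhere
along a subsequence. -/
theorem ExtendsLaplace.ae_eq_laplaceTransform {p q : ℝ≥0∞} [Fact (1 ≤ p)] [Fact (1 ≤ q)]
    {μ : Measure ℂ} {T : LpHalfLine p →L[ℂ] Lp ℂ q μ} (hT : ExtendsLaplace T) (hp : p ≠ ⊤)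
    (f : LpHalfLine p) :
    ∀ᵐ z ∂μ, 0 < z.re →
      IntegrableOn (laplaceKernel f z) (Ioi 0) ∧ T f z = laplaceTransform f z := by
  have hint : ∀ z : ℂ, 0 < z.re → IntegrableOn (laplaceKernel f z) (Ioi 0) := fun z hz =>
    integrableOn_laplaceKernel_of_memLp Fact.out hp (Lp.stronglyMeasurable f) (Lp.memLp f) hz
  obtain ⟨u, v, hu, hlim, huv, hvm, hvf, hvlim⟩ := exists_integrable_tendsto_Lp hp f
  obtain ⟨ns, hns, hae⟩ := (tendstoInMeasure_of_tendsto_Lp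
    ((T.continuous.tendsto f).comp hlim)).exists_seq_tendsto_ae
  have hTu : ∀ᵐ z ∂μ, ∀ n, T (u n) z = laplaceTransform (u n) z :=
    ae_all_iff.2 fun n => hT (u n) (hu n)
  filter_upwards [hae, hTu] with z hz hzu hre
  refine ⟨hint z hre, tendsto_nhds_unique hz ?_⟩
  have hconv : Tendsto (fun n => laplaceTransform (v n) z) atTop (𝓝 (laplaceTransform f z)) := by
    refine tendsto_integral_of_dominated_convergence (fun t => 2 * ‖laplaceKernel f z t‖)
      (fun n => (stronglyMeasurable_laplaceKernel (hvm n) z).aestronglyMeasurable)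
      ((hint z hre).norm.const_mul 2) (fun n => ?_) ?_
    · refine Eventually.of_forall fun t => ?_
      rw [norm_laplaceKernel, norm_laplaceKernel, ← mul_assoc]
      gcongr
      exact hvf n t
    · exact Eventually.of_forall fun t => (hvlim t).mul_const _
  refine (hconv.comp hns.tendsto_atTop).congr fun i => ?_
  simp only [Function.comp]
  rw [hzu, laplaceTransform_congr_ae (huv _)]

theorem IsSectorWellProjected.ae_re_nonneg {α β : ℝ} {k k' l l' : ℝ≥0} {μ : Measure ℂ}
    (hμ : IsSectorWellProjected α β k k' l l' μ) (hα : -(Real.pi / 2) ≤ α)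
    (hβ : β ≤ Real.pi / 2) : ∀ᵐ z ∂μ, 0 ≤ z.re := by
  have hsupp : ∀ᵐ z ∂μ, z ∈ closedSector α β := mem_ae_iff.2 hμ.supported
  filter_upwards [hsupp] with z hmem
  rcases hmem with rfl | ⟨h1, h2⟩
  · exact le_rfl
  · exact Complex.abs_arg_le_pi_div_two_iff.1 (abs_le.2 ⟨hα.trans h1, h2.trans hβ⟩)

theorem theorem3 (p p' : ℝ≥0∞) [Fact (1 ≤ p)] [Fact (1 ≤ p')] (hp : p ≤ 2)
    (hpp' : ENNReal.HolderConjugate p p') (k k' l l' : ℝ≥0) :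
    ∀ (α β : ℝ), -(Real.pi / 2) ≤ α → α < β → β ≤ Real.pi / 2 →
    ∀ μ : Measure ℂ, IsSectorWellProjected α β k k' l l' μ →
      ∃ T : LpHalfLine p →L[ℂ] Lp ℂ p' μ,
        ExtendsLaplace T ∧
        (∀ S : LpHalfLine p →L[ℂ] Lp ℂ p' μ, ExtendsLaplace S → S = T) ∧
        (∀ f : LpHalfLine p, ∀ᵐ z ∂μ, 0 < z.re →
          IntegrableOn (laplaceKernel f z) (Ioi (0 : ℝ)) ∧ T f z = laplaceTransform f z) ∧
        ‖T‖ ≤ (8 * Real.pi) ^ (p'⁻¹).toReal *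
          (Real.sqrt (6 * k + k') + Real.sqrt (6 * l + l')) ^ (2 * (p'⁻¹).toReal) := by
  intro α β hα _ hβ μ hμ
  have hgrowth : HasLinearGrowth (min (k + k') (l + l')) μ := by
    rcases min_choice (k + k') (l + l') with h | h <;> rw [h]
    exacts [hμ.left.hasLinearGrowth, hμ.right.hasLinearGrowth]
  obtain ⟨T, hT, huniq, hnorm⟩ :=
    hgrowth.exists_extendsLaplace (hμ.ae_re_nonneg hα hβ) hp hpp'
  refine ⟨T, hT, huniq, hT.ae_eq_laplaceTransform (hp.trans_lt (by norm_num)).ne, hnorm.trans ?_⟩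
  set m : ℝ≥0 := min (k + k') (l + l') with hm
  set a : ℝ := Real.sqrt (6 * k + k') with ha
  set b : ℝ := Real.sqrt (6 * l + l') with hb
  have hma : Real.sqrt m ≤ a := by
    refine Real.sqrt_le_sqrt ?_
    have h1 : (m : ℝ) ≤ k + k' := by exact_mod_cast min_le_left (k + k') (l + l')
    linarith [k.coe_nonneg]
  have hmb : Real.sqrt m ≤ b := by
    refine Real.sqrt_le_sqrt ?_
    have h1 : (m : ℝ) ≤ l + l' := by exact_mod_cast min_le_right (k + k') (l + l')
    linarith [l.coe_nonneg]
  -- Both square roots dominate that of `m`, so that `4 * m ≤ (a + b) ^ 2`.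
  have hab : 32 * Real.pi * m ≤ 8 * Real.pi * (a + b) ^ 2 := by
    have h1 : (2 * Real.sqrt m) ^ 2 ≤ (a + b) ^ 2 := by gcongr; linarith
    rw [mul_pow, Real.sq_sqrt m.coe_nonneg] at h1
    nlinarith [Real.pi_pos]
  rw [Real.rpow_mul (by positivity), Real.rpow_two,
    ← Real.mul_rpow (by positivity) (by positivity)]
  gcongr
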